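/- Let $\mathcal E$ be a Heyting pretopos, that is, a regular category with finite disjoint and pullback-stable coproducts in which every equivalence relation is effective and in which, for every map $f:X\to Y$, the pullback map $f^*:\mathrm{Sub}(Y)\to\mathrm{Sub}(X)$ has a right adjoint $\forall_f$. Call a commutative square, with sides $Y\to X$, $g:Y\to B$, $f:X\to A$, $h:B\to A$, a quasi-pullback if the canonical map $Y\to B\times_A X$ is an epimorphism. Let $\mathcal S$ be a family of small maps in $\mathcal E$, i.e. a class of maps such that: - $\mathcal S$ contains the isomorphisms and is closed under composition and pullback; if the pullback of $f$ along an epimorphism is in $\mathcal S$, then $f\in\mathcal S$; - $0\to 1$ and $1+1\to 1$ are in $\mathcal S$; if $f,g\in\mathcal S$ then $f+g\in\mathcal S$; if $gh\in\mathcal S$ with $h$ an epimorphism, then $g\in\mathcal S$; - (Collection) for every $f:X\to A$ in $\mathcal S$ and every epimorphism $p:P\to X$ there are an epimorphism $h:B\to A$, a map $g:Y\to B$ in $\mathcal S$ and a map $q:Y\to P$ such that $(pq,g,f,h)$ is a quasi-pullback; - (power objects) for every $X$ there are an object $\mathcal P(X)$ and a subobject $\ni_X\rightarrowtail\mathcal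 P(X)\times X$ with $\ni_X\to\mathcal P(X)$ in $\mathcal S$, such that every subobject $S\rightarrowtail A\times X$ with $S\to A$ in $\mathcal S$ equals $(\chi\times 1_X)^*(\ni_X)$ for a unique $\chi:A\to\mathcal P(X)$. Put $\Omega=\mathcal P(1)$ and let $\top:1\to\Omega$ be the map classifying the total subobject of $1$; in formulas of the internal language, $p:\Omega$ abbreviates $p=\top$. Let $J\rightarrowtail\Omega$ be a Lawvere–Tierney coverage, i.e. a subobject for which $J(\top)$ and $\forall p,q:\Omega\,[(p\Rightarrow J(q))\Rightarrow(J(p)\Rightarrow J(q))]$ are valid in $\mathcal E$. For $S\rightarrowtail X$ define the closure $$\mathbf C_X(S)=\{x:X\mid \exists p:\Omega\,(J(p)\wedge(p\Rightarrow S(x)))\}.$$ A monomorphism $m:B\rightarrowtail A$ is dense if $\mathbf C_A(B)=A$. An object $Y$ is a sheaf if for every dense monomorphism $m:B\rightarrowtail A$ the function $\hom(m,Y):\hom(A,Y)\to\hom(B,Y)$ is bijective. Let $\mathcal E_J$ be the full subcategory of sheaves, with inclusion $\mathbf i:\mathcal E_J\to\mathcal E$. For an object $X$ let $\mathcal P_J(X)$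 be the quotient of $\mathcal P(X)$ by the equivalence relation $$R=\{(s,t)\mid \forall x:X\,(x\mathrel{\overline\in}s\Leftrightarrow x\mathrel{\overline\in}t)\},$$ where $\overline\in$ is the closure of the membership relation $\ni_X$ in $\mathcal P(X)\times X$. Let $\sigma_X:X\to\mathcal P_J(X)$ be the composite of the singleton map $X\to\mathcal P(X)$ (classifying the diagonal of $X$) with the quotient map. Let $\mathbf a(X)$ be the closure in $\mathcal P_J(X)$ of the image of $\sigma_X$, and let $\eta_X:X\to\mathbf a(X)$ be the map induced by $\sigma_X$. Then: 1. for every object $X$ of $\mathcal E$, $\mathbf a(X)$ is a sheaf; 2. for every object $X$, every sheaf $Y$ and every map $f:X\to Y$, there is a unique map $\bar f:\mathbf a(X)\to Y$ with $\bar f\,\eta_X=f$; 3. the resulting functor $\mathbf a:\mathcal E\to\mathcal E_J$ (sending $f:X\to Y$ to the unique map $\mathbf a(f)$ with $\mathbf a(f)\,\eta_X=\eta_Y f$) is left adjoint to $\mathbf i$, with unit $\eta$, and preserves finite limits. -/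

import Mathlib

open CategoryTheory CategoryTheory.Limits

universe v u

noncomputable section

namespace LTSheaves

/-- A Heyting pretopos: a regular category with finite disjoint and stable coproducts in which every
internal equivalence relation is effective and every pullback map between subobject posets has a
right adjoint (universal quantification). -/
class HeytingPretopos (C : Type u) [Category.{v} C] : Prop
    extends Regular C, FinitaryExtensive C where
  effective : ∀ {R X : C} (p₁ p₂ : R ⟶ X), IsEquivalenceRelation p₁ p₂ →
    IsEffectiveEquivalenceRelation p₁ p₂
  exists_forall : ∀ {X Y : C} (f : X ⟶ Y), ∃ r : Subobject X → Subobject Y,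
    GaloisConnection (fun T : Subobject Y => (Subobject.pullback f).obj T) r

variable {C : Type u} [Category.{v} C] [HeytingPretopos C]

section InternalLogic

/-! ### Subobjects as formulas: substitution, quantifiers, implication -/

/-- Inverse image of subobjects (substitution). -/
abbrev pb {X Y : C} (f : X ⟶ Y) (T : Subobject Y) : Subobject X :=
  (Subobject.pullback f).obj T

/-- Existential quantification (image) along `f`. -/
abbrev ex {X Y : C} (f : X ⟶ Y) (S : Subobject X) : Subobject Y :=
  (Subobject.exists f).obj S

/-- Universal quantification along `f`: the right adjoint of `pb f`. -/
def all {X Y : C} (f : X ⟶ Y) : Subobject X → Subobject Y :=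
  (HeytingPretopos.exists_forall f).choose

theorem pb_le_iff {X Y : C} (f : X ⟶ Y) (T : Subobject Y) (S : Subobject X) :
    pb f T ≤ S ↔ T ≤ all f S :=
  (HeytingPretopos.exists_forall f).choose_spec T S

theorem ex_le_iff {X Y : C} (f : X ⟶ Y) (S : Subobject X) (T : Subobject Y) :
    ex f S ≤ T ↔ S ≤ pb f T :=
  ⟨fun h => leOfHom ((Subobject.existsPullbackAdj f).homEquiv S T (homOfLE h)),
   fun h => leOfHom (((Subobject.existsPullbackAdj f).homEquiv S T).symm (homOfLE h))⟩

theorem pb_mono {X Y : C} (f : X ⟶ Y) {S T : Subobject Y} (h : S ≤ T) : pb f S ≤ pb f T :=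
  (Subobject.pullback f).monotone h

theorem pb_id {X : C} (S : Subobject X) : pb (𝟙 X) S = S :=
  Subobject.pullback_id S

theorem pb_comp {X Y Z : C} (f : X ⟶ Y) (g : Y ⟶ Z) (S : Subobject Z) :
    pb (f ≫ g) S = pb f (pb g S) :=
  Subobject.pullback_comp f g S

theorem pb_top {X Y : C} (f : X ⟶ Y) : pb f ⊤ = ⊤ :=
  Subobject.pullback_top f

theorem pb_inf {X Y : C} (f : X ⟶ Y) (S T : Subobject Y) : pb f (S ⊓ T) = pb f S ⊓ pb f T :=
  Subobject.inf_pullback f S T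

theorem factors_iff_pb_eq_top {X Y : C} (f : X ⟶ Y) (S : Subobject Y) :
    S.Factors f ↔ pb f S = ⊤ := by
  have h : S.Factors f ↔ (pb f S).Factors (𝟙 X) := by
    rw [pullback_factors_iff, Category.id_comp]
  rw [h]
  constructor
  · intro h
    refine top_le_iff.1 (Subobject.le_of_factors ?_)
    rw [← Category.comp_id (⊤ : Subobject X).arrow]
    exact Subobject.factors_of_factors_right _ h
  · intro h
    rw [h]
    exact Subobject.top_factors _

/-- Implication (relative pseudo-complement) of subobjects. -/
def imp {X : C} (S T : Subobject X) : Subobject X :=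
  all S.arrow (pb S.arrow T)

theorem le_imp_iff {X : C} (U S T : Subobject X) : U ≤ imp S T ↔ U ⊓ S ≤ T := by
  have key : U ⊓ S = (Subobject.map S.arrow).obj (pb S.arrow U) := by
    rw [inf_comm, Subobject.inf_eq_map_pullback]
  rw [imp, ← pb_le_iff, key]
  exact ⟨fun h => leOfHom (((Subobject.mapPullbackAdj S.arrow).homEquiv _ _).symm (homOfLE h)),
    fun h => leOfHom ((Subobject.mapPullbackAdj S.arrow).homEquiv _ _ (homOfLE h))⟩

/-- Logical equivalence of subobjects. -/
def biimp {X : C} (S T : Subobject X) : Subobject X :=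
  imp S T ⊓ imp T S

/-- Stability of images under pullback. -/
theorem pb_ex_le {P X A Y : C} {k : P ⟶ X} {g : P ⟶ A} {f : X ⟶ Y} {h : A ⟶ Y}
    (sq : IsPullback k g f h) (U : Subobject A) : pb f (ex h U) ≤ ex k (pb g U) := by
  let F := (Subobject.imageFactorisation h U).F
  let e : (U : C) ⟶ (ex h U : C) := F.e
  have he : e ≫ (ex h U).arrow = U.arrow ≫ h := by
    rw [← F.fac, Subobject.imageFactorisation_F_m]
    rfl
  have : StrongEpi e := strongEpi_of_strongEpiMonoFactorisation
    (Regular.strongEpiMonoFactorisation (U.arrow ≫ h)) (Subobject.imageFactorisation h U).isImage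
  have : IsRegularEpi e := inferInstance
  let Q := pb f (ex h U)
  let π : (Q : C) ⟶ (ex h U : C) := Subobject.pullbackπ f (ex h U)
  have hQ : π ≫ (ex h U).arrow = Q.arrow ≫ f := (Subobject.isPullback f (ex h U)).w
  let r : pullback π e ⟶ (Q : C) := pullback.fst π e
  let l : pullback π e ⟶ P := sq.lift (r ≫ Q.arrow) (pullback.snd π e ≫ U.arrow) (by
    rw [Category.assoc, Category.assoc, ← hQ, ← he, ← Category.assoc, ← Category.assoc,
      pullback.condition])
  have h1 : (pb g U).Factors l := by
    rw [pullback_factors_iff, sq.lift_snd]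
    exact Subobject.factors_comp_arrow _
  have h2 : (ex k (pb g U)).Factors (l ≫ k) := by
    rw [← pullback_factors_iff]
    exact Subobject.factors_of_le _ ((ex_le_iff _ _ _).1 le_rfl) h1
  rw [sq.lift_fst] at h2
  have comm : CommSq (Subobject.factorThru _ _ h2) r (ex k (pb g U)).arrow Q.arrow :=
    ⟨by rw [Subobject.factorThru_arrow]⟩
  exact Subobject.le_of_comm comm.lift comm.fac_right

/-- The Beck-Chevalley condition for universal quantification. -/
theorem pb_all {P X A Y : C} {k : P ⟶ X} {g : P ⟶ A} {f : X ⟶ Y} {h : A ⟶ Y}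
    (sq : IsPullback k g f h) (S : Subobject X) : pb h (all f S) = all g (pb k S) := by
  apply eq_of_forall_le_iff
  intro U
  rw [← ex_le_iff, ← pb_le_iff, ← pb_le_iff, ← ex_le_iff]
  refine ⟨fun H => le_trans ?_ H, fun H => (pb_ex_le sq U).trans H⟩
  rw [ex_le_iff, ← pb_comp, sq.w, pb_comp]
  exact pb_mono g ((ex_le_iff _ _ _).1 le_rfl)

theorem pb_imp {X Y : C} (f : X ⟶ Y) (S T : Subobject Y) :
    pb f (imp S T) = imp (pb f S) (pb f T) := by
  rw [imp, pb_all (Subobject.isPullback f S), imp, ← pb_comp, (Subobject.isPullback f S).w,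
    pb_comp]

theorem biimp_eq_top_iff {X : C} (S T : Subobject X) : biimp S T = ⊤ ↔ S = T := by
  rw [biimp, ← top_le_iff, le_inf_iff, le_imp_iff, le_imp_iff, top_inf_eq, top_inf_eq]
  exact ⟨fun h => le_antisymm h.1 h.2, fun h => ⟨h.le, h.ge⟩⟩

theorem all_eq_top_iff {X Y : C} (f : X ⟶ Y) (S : Subobject X) : all f S = ⊤ ↔ S = ⊤ := by
  rw [← top_le_iff, ← pb_le_iff, pb_top, top_le_iff]

end InternalLogic

section SmallMaps

/-! ### Families of small maps -/

/-- A commutative square with top `k`, left `g`, right `f`, bottom `h` is a quasi-pullback if the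
canonical map to the pullback is an epimorphism. -/
def IsQuasiPullback {Y X B A : C} (k : Y ⟶ X) (g : Y ⟶ B) (f : X ⟶ A) (h : B ⟶ A) : Prop :=
  ∃ w : g ≫ h = k ≫ f, Epi (pullback.lift g k w : Y ⟶ pullback h f)

/-- The subobject `S` of `A ⨯ X` is an `A`-indexed family of `𝒮`-subobjects of `X`. -/
def IsIndexedFamily (𝒮 : MorphismProperty C) {A X : C} (S : Subobject (A ⨯ X)) : Prop :=
  𝒮 (S.arrow ≫ prod.fst)

/-- A power object of `X`, with its membership relation, classifying indexed families of
`𝒮`-subobjects of `X`. -/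
structure PowerObject (𝒮 : MorphismProperty C) (X : C) where
  obj : C
  mem : Subobject (obj ⨯ X)
  mem_small : IsIndexedFamily 𝒮 mem
  classify : ∀ {A : C} (S : Subobject (A ⨯ X)), IsIndexedFamily 𝒮 S →
    ∃! χ : A ⟶ obj, pb (prod.map χ (𝟙 X)) mem = S

/-- A family of small maps: a class of maps containing isomorphisms, closed under composition and
satisfying Pullback Stability, Descent, the finiteness axioms, Quotients, Collection, and having
power objects. -/
class IsFamilyOfSmallMaps (𝒮 : MorphismProperty C) : Prop where
  of_isIso : ∀ {X Y : C} (f : X ⟶ Y), IsIso f → 𝒮 f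
  comp : ∀ {X Y Z : C} (f : X ⟶ Y) (g : Y ⟶ Z), 𝒮 f → 𝒮 g → 𝒮 (f ≫ g)
  /-- Pullback Stability -/
  pullback_stable : ∀ {Y X B A : C} {k : Y ⟶ X} {g : Y ⟶ B} {f : X ⟶ A} {h : B ⟶ A},
    IsPullback k g f h → 𝒮 f → 𝒮 g
  /-- Descent -/
  descent : ∀ {Y X B A : C} {k : Y ⟶ X} {g : Y ⟶ B} {f : X ⟶ A} {h : B ⟶ A},
    IsPullback k g f h → Epi h → 𝒮 g → 𝒮 f
  zero_one : 𝒮 (terminal.from (⊥_ C))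
  two_one : 𝒮 (terminal.from ((⊤_ C) ⨿ (⊤_ C)))
  sum : ∀ {X A Y B : C} (f : X ⟶ A) (g : Y ⟶ B), 𝒮 f → 𝒮 g → 𝒮 (coprod.map f g)
  /-- Quotients -/
  quotient : ∀ {X Y A : C} (h : X ⟶ Y) (g : Y ⟶ A), Epi h → 𝒮 (h ≫ g) → 𝒮 g
  /-- Collection -/
  collection : ∀ {P X A : C} (f : X ⟶ A) (p : P ⟶ X), 𝒮 f → Epi p →
    ∃ (Y B : C) (q : Y ⟶ P) (g : Y ⟶ B) (h : B ⟶ A),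
      𝒮 g ∧ Epi h ∧ IsQuasiPullback (q ≫ p) g f h
  power : ∀ X : C, Nonempty (PowerObject 𝒮 X)

variable (𝒮 : MorphismProperty C) [IsFamilyOfSmallMaps 𝒮]

/-- A power object of `X` (unique up to unique isomorphism). -/
def powerObject (X : C) : PowerObject 𝒮 X :=
  (IsFamilyOfSmallMaps.power X).some

/-- The power object `P(X)`. -/
abbrev Pow (X : C) : C := (powerObject 𝒮 X).obj

/-- The membership relation, as a subobject of `P(X) ⨯ X`. -/
abbrev mem (X : C) : Subobject (Pow 𝒮 X ⨯ X) := (powerObject 𝒮 X).mem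

/-- The map `A ⟶ P(X)` classifying an indexed family. -/
def chi {A X : C} (S : Subobject (A ⨯ X)) (hS : IsIndexedFamily 𝒮 S) : A ⟶ Pow 𝒮 X :=
  ((powerObject 𝒮 X).classify S hS).choose

theorem diag_isIndexedFamily (X : C) :
    IsIndexedFamily 𝒮 (Subobject.mk (prod.lift (𝟙 X) (𝟙 X))) := by
  apply IsFamilyOfSmallMaps.of_isIso
  rw [← Subobject.underlyingIso_hom_comp_eq_mk, Category.assoc, prod.lift_fst, Category.comp_id]
  infer_instance

/-- The singleton map `X ⟶ P(X)`, classifying the diagonal of `X`. -/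
def singleton (X : C) : X ⟶ Pow 𝒮 X :=
  chi 𝒮 (Subobject.mk (prod.lift (𝟙 X) (𝟙 X))) (diag_isIndexedFamily 𝒮 X)

/-- The object `Ω = P(1)` of small truth values. -/
abbrev Om : C := Pow 𝒮 (⊤_ C)

theorem top_isIndexedFamily :
    IsIndexedFamily 𝒮 (⊤ : Subobject ((⊤_ C) ⨯ (⊤_ C))) := by
  apply IsFamilyOfSmallMaps.of_isIso
  have : IsIso (prod.fst : (⊤_ C) ⨯ (⊤_ C) ⟶ ⊤_ C) :=
    ⟨prod.lift (𝟙 _) (𝟙 _), by ext, Subsingleton.elim _ _⟩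
  infer_instance

/-- The global element `⊤ : 1 ⟶ Ω`, classifying the total subobject of `1`. -/
def truth : (⊤_ C) ⟶ Om 𝒮 :=
  chi 𝒮 ⊤ (top_isIndexedFamily 𝒮)

/-- The subobject `{p : Ω | p}`, that is `{p : Ω | p = ⊤}`. -/
def Tr : Subobject (Om 𝒮) := Subobject.mk (truth 𝒮)

/-- A Lawvere-Tierney coverage: a subobject `J` of `Ω` validating
`J(⊤)` and `∀ p q : Ω, (p ⇒ J(q)) ⇒ (J(p) ⇒ J(q))`. -/
structure LTCoverage where
  J : Subobject (Om 𝒮)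
  top_mem : pb (truth 𝒮) J = ⊤
  trans :
    imp (imp (pb (prod.fst : Om 𝒮 ⨯ Om 𝒮 ⟶ Om 𝒮) (Tr 𝒮)) (pb prod.snd J))
      (imp (pb prod.fst J) (pb prod.snd J)) = ⊤

end SmallMaps

section Sheaves

/-! ### Closure, density and sheaves -/

variable {𝒮 : MorphismProperty C} [IsFamilyOfSmallMaps 𝒮] (J : LTCoverage 𝒮)

/-- The closure `{x : X | ∃ p : Ω, J(p) ∧ (p ⇒ S(x))}` of a subobject `S` of `X`. -/
def closure {X : C} (S : Subobject X) : Subobject X :=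
  ex (prod.snd : Om 𝒮 ⨯ X ⟶ X)
    (pb prod.fst J.J ⊓ imp (pb prod.fst (Tr 𝒮)) (pb prod.snd S))

theorem le_closure {X : C} (S : Subobject X) : S ≤ closure J S := by
  let Y : Subobject (Om 𝒮 ⨯ X) := pb prod.fst J.J ⊓ imp (pb prod.fst (Tr 𝒮)) (pb prod.snd S)
  let s : X ⟶ Om 𝒮 ⨯ X := prod.lift (terminal.from X ≫ truth 𝒮) (𝟙 X)
  have hs (T : Subobject X) : pb s (pb prod.snd T) = T := by
    rw [← pb_comp, prod.lift_snd, pb_id]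
  have h1 : S ≤ pb s Y := by
    rw [pb_inf]
    refine le_inf ?_ ?_
    · rw [← pb_comp, prod.lift_fst, pb_comp, J.top_mem, pb_top]
      exact le_top
    · conv_lhs => rw [← hs S]
      apply pb_mono
      rw [le_imp_iff]
      exact inf_le_left
  have h2 : pb s Y ≤ pb s (pb prod.snd (ex prod.snd Y)) :=
    pb_mono s ((ex_le_iff _ _ _).1 le_rfl)
  rw [hs] at h2
  exact h1.trans h2

/-- A monomorphism is dense if its closure is the whole codomain. -/
def IsDense {B A : C} (m : B ⟶ A) [Mono m] : Prop :=
  closure J (Subobject.mk m) = ⊤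

/-- `X` is a sheaf if every map from the domain of a dense monomorphism to `X` has exactly one
extension along it. -/
def IsSheaf : ObjectProperty C := fun X =>
  ∀ ⦃B A : C⦄ (m : B ⟶ A) [Mono m], IsDense J m →
    Function.Bijective (fun w : A ⟶ X => m ≫ w)

/-- The full subcategory of sheaves. -/
abbrev Sh : Type u := (IsSheaf J).FullSubcategory

/-- The inclusion of sheaves. -/
abbrev incl : Sh J ⥤ C := (IsSheaf J).ι

end Sheaves

section Quotient

/-! ### The object `P_J(X)` -/

variable {𝒮 : MorphismProperty C} [IsFamilyOfSmallMaps 𝒮] (J : LTCoverage 𝒮)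

/-- The relation `R = {(s,t) | ∀ x : X, x ∈ closure s ⇔ x ∈ closure t}` on `P(X)`. -/
def closureRel (X : C) : Subobject (Pow 𝒮 X ⨯ Pow 𝒮 X) :=
  all (prod.fst : (Pow 𝒮 X ⨯ Pow 𝒮 X) ⨯ X ⟶ Pow 𝒮 X ⨯ Pow 𝒮 X)
    (biimp (pb (prod.map prod.fst (𝟙 X)) (closure J (mem 𝒮 X)))
      (pb (prod.map prod.snd (𝟙 X)) (closure J (mem 𝒮 X))))

/-- In terms of generalized elements, `R(s,t)` says that `s` and `t` have the same closure. -/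
theorem closureRel_factors_iff {X A : C} (a b : A ⟶ Pow 𝒮 X) :
    (closureRel J X).Factors (prod.lift a b) ↔
      pb (prod.map a (𝟙 X)) (closure J (mem 𝒮 X)) =
        pb (prod.map b (𝟙 X)) (closure J (mem 𝒮 X)) := by
  have sq : IsPullback (prod.map (prod.lift a b) (𝟙 X)) (prod.fst : A ⨯ X ⟶ A)
      (prod.fst : (Pow 𝒮 X ⨯ Pow 𝒮 X) ⨯ X ⟶ Pow 𝒮 X ⨯ Pow 𝒮 X) (prod.lift a b) := by
    refine ⟨⟨by simp only [prod.map_fst]⟩,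
      ⟨PullbackCone.IsLimit.mk _ (fun s => prod.lift s.snd (s.fst ≫ prod.snd)) ?_ ?_ ?_⟩⟩
    · intro s
      have := s.condition
      apply prod.hom_ext
      · simp only [Category.assoc, prod.map_fst, prod.lift_fst_assoc, this]
      · simp only [Category.assoc, prod.map_snd, Category.comp_id, prod.lift_snd]
    · intro s
      simp only [prod.lift_fst]
    · intro s m h1 h2
      apply prod.hom_ext
      · simp only [prod.lift_fst, h2]
      · simp only [prod.lift_snd, ← h1, Category.assoc, prod.map_snd, Category.comp_id]
  rw [factors_iff_pb_eq_top, closureRel, pb_all sq, all_eq_top_iff, biimp, pb_inf, pb_imp, pb_imp,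
    ← biimp, biimp_eq_top_iff, ← pb_comp, ← pb_comp, prod.map_map, prod.map_map, prod.lift_fst,
    prod.lift_snd, Category.comp_id]

/-- The first projection `R ⟶ P(X)`. -/
abbrev closureRel₁ (X : C) : (closureRel J X : C) ⟶ Pow 𝒮 X := (closureRel J X).arrow ≫ prod.fst

/-- The second projection `R ⟶ P(X)`. -/
abbrev closureRel₂ (X : C) : (closureRel J X : C) ⟶ Pow 𝒮 X := (closureRel J X).arrow ≫ prod.snd

theorem closureRel_pb_eq {X A : C} (r : A ⟶ (closureRel J X : C)) :
    pb (prod.map (r ≫ closureRel₁ J X) (𝟙 X)) (closure J (mem 𝒮 X)) =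
      pb (prod.map (r ≫ closureRel₂ J X) (𝟙 X)) (closure J (mem 𝒮 X)) := by
  rw [← closureRel_factors_iff]
  have : prod.lift (r ≫ closureRel₁ J X) (r ≫ closureRel₂ J X) = r ≫ (closureRel J X).arrow := by
    apply prod.hom_ext
    · rw [prod.lift_fst, Category.assoc]
    · rw [prod.lift_snd, Category.assoc]
  rw [this]
  exact Subobject.factors_comp_arrow _

theorem closureRel_exists {X A : C} (a b : A ⟶ Pow 𝒮 X)
    (h : pb (prod.map a (𝟙 X)) (closure J (mem 𝒮 X)) =
        pb (prod.map b (𝟙 X)) (closure J (mem 𝒮 X))) :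
    ∃ r : A ⟶ (closureRel J X : C), r ≫ closureRel₁ J X = a ∧ r ≫ closureRel₂ J X = b := by
  have hf := (closureRel_factors_iff J a b).2 h
  refine ⟨(closureRel J X).factorThru _ hf, ?_, ?_⟩
  · rw [← Category.assoc, Subobject.factorThru_arrow, prod.lift_fst]
  · rw [← Category.assoc, Subobject.factorThru_arrow, prod.lift_snd]

theorem closureRel_isEquivalenceRelation (X : C) :
    IsEquivalenceRelation (closureRel₁ J X) (closureRel₂ J X) := by
  obtain ⟨r, hr₁, hr₂⟩ := closureRel_exists J (𝟙 (Pow 𝒮 X)) (𝟙 _) rfl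
  have hid := closureRel_pb_eq J (𝟙 (closureRel J X : C))
  rw [Category.id_comp, Category.id_comp] at hid
  obtain ⟨s, hs₁, hs₂⟩ := closureRel_exists J (closureRel₂ J X) (closureRel₁ J X) hid.symm
  let p := pullback.fst (closureRel₂ J X) (closureRel₁ J X)
  let q := pullback.snd (closureRel₂ J X) (closureRel₁ J X)
  have hpq : p ≫ closureRel₂ J X = q ≫ closureRel₁ J X := pullback.condition
  have hp := closureRel_pb_eq J p
  have hq := closureRel_pb_eq J q
  rw [hpq] at hp
  obtain ⟨t, ht₁, ht₂⟩ := closureRel_exists J _ _ (hp.trans hq)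
  exact ⟨⟨{
    right_cancellation := fun Y f g h₁ h₂ => by
      rw [← cancel_mono (closureRel J X).arrow]
      ext
      · simpa only [Category.assoc] using h₁
      · simpa only [Category.assoc] using h₂
    r := r
    reflexivity₁ := hr₁
    reflexivity₂ := hr₂
    s := s
    symmetry₁ := hs₁
    symmetry₂ := hs₂
    c := pullback.cone _ _
    isLimit := pullback.isLimit _ _
    t := t
    transitivity₁ := ht₁
    transitivity₂ := ht₂ }⟩⟩

instance hasCoequalizer_closureRel (X : C) :
    HasCoequalizer (closureRel₁ J X) (closureRel₂ J X) := by
  obtain ⟨⟨e⟩⟩ := HeytingPretopos.effective _ _ (closureRel_isEquivalenceRelation J X)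
  exact ⟨⟨_, EffectiveEquivalenceRelation.isCoequalizer _ _ e⟩⟩

/-- The object `P_J(X)`: the quotient of `P(X)` by the relation `R`. -/
def PowJ (X : C) : C := coequalizer (closureRel₁ J X) (closureRel₂ J X)

/-- The quotient map `[·] : P(X) ⟶ P_J(X)`. -/
def quot (X : C) : Pow 𝒮 X ⟶ PowJ J X := coequalizer.π (closureRel₁ J X) (closureRel₂ J X)

/-- The map `X ⟶ P_J(X)`, sending `x` to `[{x}]`. -/
def sigma (X : C) : X ⟶ PowJ J X := singleton 𝒮 X ≫ quot J X

/-- The image of `X ⟶ P_J(X)`. -/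
abbrev imageSigma (X : C) : Subobject (PowJ J X) := imageSubobject (sigma J X)

/-- The object `a(X)`: the closure in `P_J(X)` of the image of `X ⟶ P_J(X)`. -/
def assoc (X : C) : C := (closure J (imageSigma J X) : C)

/-- The map `η_X : X ⟶ a(X)`: the corestriction of `X ⟶ P_J(X)` to its image, followed by the
inclusion of the image in its closure. -/
def eta (X : C) : X ⟶ assoc J X :=
  factorThruImageSubobject (sigma J X) ≫ Subobject.ofLE _ _ (le_closure J (imageSigma J X))

end Quotient

section AssociatedSheaf

/-! ### The functor determined by a universal family of maps into sheaves -/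

variable {𝒮 : MorphismProperty C} [IsFamilyOfSmallMaps 𝒮] (J : LTCoverage 𝒮)

/-- `η_X : X ⟶ a(X)` is universal among maps from `X` to sheaves. -/
def IsUniversal (X : C) : Prop :=
  ∀ (Y : C), IsSheaf J Y → ∀ f : X ⟶ Y, ∃! g : assoc J X ⟶ Y, eta J X ≫ g = f

/-- The functor `X ↦ a(X)` resulting from the universal property of the maps `η_X`: its value on
`f : X ⟶ Y` is the unique map `a(X) ⟶ a(Y)` commuting with `f`, `η_X` and `η_Y`. -/
def assocFunctor (hs : ∀ X, IsSheaf J (assoc J X)) (hu : ∀ X, IsUniversal J X) : C ⥤ Sh J where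
  obj X := ⟨assoc J X, hs X⟩
  map {X Y} f := ObjectProperty.homMk (hu X _ (hs Y) (f ≫ eta J Y)).choose
  map_id X := by
    ext
    refine (hu X _ (hs X) (𝟙 X ≫ eta J X)).unique
      (hu X _ (hs X) (𝟙 X ≫ eta J X)).choose_spec.1 ?_
    exact (Category.comp_id _).trans (Category.id_comp _).symm
  map_comp {X Y Z} f g := by
    ext
    refine (hu X _ (hs Z) ((f ≫ g) ≫ eta J Z)).unique
      (hu X _ (hs Z) ((f ≫ g) ≫ eta J Z)).choose_spec.1 ?_
    have h1 : eta J X ≫ (hu X _ (hs Y) (f ≫ eta J Y)).choose = f ≫ eta J Y :=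
      (hu X _ (hs Y) (f ≫ eta J Y)).choose_spec.1
    have h2 : eta J Y ≫ (hu Y _ (hs Z) (g ≫ eta J Z)).choose = g ≫ eta J Z :=
      (hu Y _ (hs Z) (g ≫ eta J Z)).choose_spec.1
    change eta J X ≫ (hu X _ (hs Y) (f ≫ eta J Y)).choose ≫
      (hu Y _ (hs Z) (g ≫ eta J Z)).choose = (f ≫ g) ≫ eta J Z
    rw [← Category.assoc, h1, Category.assoc, h2, Category.assoc]

end AssociatedSheaf

end LTSheaves

end

/-! The internal language is read through generalized elements, in Kripke–Joyal style. A map to Ω is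
a small subobject of its domain, and J singles out the covering ones. An element x lies in the
closure of S iff, after passing to an epimorphic cover, some covering subobject carries x into S.
Closure therefore commutes with pullback. Idempotence is the first use of Collection: covers chosen
locally over a covering U are pushed forward along a small map to a single small cover of the base
(`closure_closure`). A map A → P_J(X) is the same as its closed family in A × X. Such families are
determined on a covering subobject, so P_J(X) is separated. To extend a map given on a covering U,
lift it locally to P(X) and use Collection to take the union of the lifts along a small map; the
closure of this union restricts to the given family (`isSheaf_powJ`). Hence P_J(X), and its closed
subobject a(X), are sheaves. Call a map a local equivalence if its image is dense and elements it
identifies are densely equal. Precomposition with one is bijective on maps into sheaves: descend to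
the image, then extend (`IsLocalEquiv.bijective`). The unit η is a local equivalence: its image is
dense by construction, and equal closures of {a} and {b} force a = b densely. This gives the
universal property and the adjunction. Local equivalences are stable under composition and base
change, so X ×_Z Y → aX ×_{aZ} aY is one, as is X ×_Z Y → a(X ×_Z Y). Both targets are sheaves, so
the comparison map is invertible (`isIso_pullbackComparison`). Epimorphisms in the axioms are usable
as covers because a Heyting pretopos is balanced (`isIso_of_mono_epi`). -/

noncomputable section

namespace LTSheaves

variable {C : Type u} [Category.{v} C]

section GeneralizedElements

/-! ### Subobjects and generalized elements -/

/-- The generalized element `x` of `X` belongs to the subobject `S`. -/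
def Holds {X T : C} (S : Subobject X) (x : T ⟶ X) : Prop := S.Factors x

theorem Holds.fac {X T : C} {S : Subobject X} {x : T ⟶ X} (h : Holds S x) :
    S.factorThru x h ≫ S.arrow = x :=
  Subobject.factorThru_arrow _ _ _

theorem Holds.exists_lift {X T : C} {S : Subobject X} {x : T ⟶ X} (h : Holds S x) :
    ∃ u : T ⟶ (S : C), u ≫ S.arrow = x :=
  ⟨_, h.fac⟩

theorem holds_arrow {X : C} (S : Subobject X) : Holds S S.arrow :=
  Subobject.factors_self S

theorem holds_comp_arrow {X T : C} {S : Subobject X} (t : T ⟶ (S : C)) : Holds S (t ≫ S.arrow) :=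
  Subobject.factors_comp_arrow t

theorem holds_top {X T : C} (x : T ⟶ X) : Holds ⊤ x :=
  Subobject.top_factors x

theorem Holds.comp {X T T' : C} {S : Subobject X} {x : T ⟶ X} (h : Holds S x) (t : T' ⟶ T) :
    Holds S (t ≫ x) :=
  Subobject.factors_of_factors_right t h

theorem Holds.of_le {X T : C} {S S' : Subobject X} {x : T ⟶ X} (h : Holds S x) (h' : S ≤ S') :
    Holds S' x :=
  Subobject.factors_of_le x h' h

theorem le_of_forall_holds {X : C} {S S' : Subobject X}
    (h : ∀ ⦃T : C⦄ (x : T ⟶ X), Holds S x → Holds S' x) : S ≤ S' :=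
  Subobject.le_of_factors (h _ (holds_arrow S))

theorem eq_of_forall_holds {X : C} {S S' : Subobject X}
    (h : ∀ ⦃T : C⦄ (x : T ⟶ X), Holds S x ↔ Holds S' x) : S = S' :=
  le_antisymm (le_of_forall_holds fun _ x => (h x).1) (le_of_forall_holds fun _ x => (h x).2)

theorem holds_mk_iff {X Y T : C} (f : Y ⟶ X) [Mono f] (x : T ⟶ X) :
    Holds (Subobject.mk f) x ↔ ∃ y, y ≫ f = x := by
  rw [Holds, Subobject.mk_factors_iff]
  rfl

/-- Membership is local along covers: the lift is the diagonal filler of a strong epi against a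
mono. -/
theorem Holds.of_comp {X T T' : C} {S : Subobject X} {x : T ⟶ X} (e : T' ⟶ T) [StrongEpi e]
    (h : Holds S (e ≫ x)) : Holds S x := by
  have comm : CommSq (S.factorThru _ h) e S.arrow x := ⟨S.factorThru_arrow _ h⟩
  rw [← comm.fac_right]
  exact holds_comp_arrow _

/-- Descent of maps along regular epimorphisms. -/
theorem exists_desc {X Y Z : C} (e : X ⟶ Y) [IsRegularEpi e] (g : X ⟶ Z)
    (h : ∀ ⦃T : C⦄ (a b : T ⟶ X), a ≫ e = b ≫ e → a ≫ g = b ≫ g) : ∃ d : Y ⟶ Z, e ≫ d = g :=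
  ⟨EffectiveEpi.desc e g fun a b hab => h a b hab, EffectiveEpi.fac e g _⟩

variable [HeytingPretopos C]

theorem holds_inf_iff {X T : C} (S S' : Subobject X) (x : T ⟶ X) :
    Holds (S ⊓ S') x ↔ Holds S x ∧ Holds S' x :=
  Subobject.inf_factors x

theorem holds_pb_iff {X Y T : C} (f : X ⟶ Y) (S : Subobject Y) (x : T ⟶ X) :
    Holds (pb f S) x ↔ Holds S (x ≫ f) :=
  pullback_factors_iff f S x

theorem holds_iff_pb_eq_top {X T : C} (S : Subobject X) (x : T ⟶ X) : Holds S x ↔ pb x S = ⊤ :=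
  factors_iff_pb_eq_top x S

/-- The forcing clause for implication, available because implication is stable under substitution.
-/
theorem holds_imp_iff {X T : C} (S S' : Subobject X) (x : T ⟶ X) :
    Holds (imp S S') x ↔ ∀ ⦃T' : C⦄ (t : T' ⟶ T), Holds S (t ≫ x) → Holds S' (t ≫ x) := by
  constructor
  · intro h T' t ht
    exact ((holds_inf_iff _ _ _).2 ⟨h.comp t, ht⟩).of_le ((le_imp_iff _ _ _).1 le_rfl)
  · intro h
    rw [holds_iff_pb_eq_top, pb_imp, ← top_le_iff, le_imp_iff, top_inf_eq]
    apply le_of_forall_holds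
    intro T' t ht
    rw [holds_pb_iff] at ht ⊢
    exact h t ht

theorem holds_biimp_iff {X T : C} (S S' : Subobject X) (x : T ⟶ X) :
    Holds (biimp S S') x ↔ pb x S = pb x S' := by
  rw [holds_iff_pb_eq_top, biimp, pb_inf, pb_imp, pb_imp, ← biimp, biimp_eq_top_iff]

theorem holds_ex {X Y T : C} (f : X ⟶ Y) {S : Subobject X} {y : T ⟶ X} (h : Holds S y) :
    Holds (ex f S) (y ≫ f) := by
  rw [← holds_pb_iff]
  exact h.of_le ((ex_le_iff _ _ _).1 le_rfl)

/-- The image factorization of a subobject along `f`. -/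
theorem exists_ex_cover {X Y : C} (f : X ⟶ Y) (S : Subobject X) :
    ∃ q : (S : C) ⟶ (ex f S : C), IsRegularEpi q ∧ q ≫ (ex f S).arrow = S.arrow ≫ f := by
  let F := (Subobject.imageFactorisation f S).F
  let q : (S : C) ⟶ (ex f S : C) := F.e
  have : StrongEpi q := strongEpi_of_strongEpiMonoFactorisation
    (Regular.strongEpiMonoFactorisation (S.arrow ≫ f)) (Subobject.imageFactorisation f S).isImage
  refine ⟨q, inferInstance, ?_⟩
  rw [← F.fac, Subobject.imageFactorisation_F_m]
  rfl

/-- The forcing clause for ∃: a witness exists only after pulling back the image cover along x. -/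
theorem Holds.exists_of_ex {X Y T : C} {f : X ⟶ Y} {S : Subobject X} {x : T ⟶ Y}
    (h : Holds (ex f S) x) :
    ∃ (T' : C) (e : T' ⟶ T) (y : T' ⟶ X), IsRegularEpi e ∧ Holds S y ∧ y ≫ f = e ≫ x := by
  obtain ⟨q, hq, hqf⟩ := exists_ex_cover f S
  obtain ⟨l, hl⟩ := h.exists_lift
  refine ⟨_, pullback.fst l q, pullback.snd l q ≫ S.arrow, inferInstance, holds_comp_arrow _, ?_⟩
  rw [Category.assoc, ← hqf, ← pullback.condition_assoc, hl]

theorem Holds.exists_of_imageSubobject {X Y T : C} {f : X ⟶ Y} {x : T ⟶ Y}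
    (h : Holds (imageSubobject f) x) :
    ∃ (T' : C) (e : T' ⟶ T) (y : T' ⟶ X), IsRegularEpi e ∧ y ≫ f = e ≫ x := by
  have hf : Holds (ex f ⊤) f := by
    simpa only [Category.id_comp] using holds_ex f (holds_top (𝟙 X))
  have : imageSubobject f ≤ ex f ⊤ := imageSubobject_le _ _ hf.fac
  obtain ⟨T', e, y, he, -, hy⟩ := (h.of_le this).exists_of_ex
  exact ⟨T', e, y, he, hy⟩

theorem holds_imageSubobject {X Y : C} (f : X ⟶ Y) : Holds (imageSubobject f) f := by
  have := holds_comp_arrow (S := imageSubobject f) (factorThruImageSubobject f)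
  rwa [imageSubobject_arrow_comp] at this

end GeneralizedElements

section Exactness

/-! ### Quotients by equivalence relations, and balancedness -/

variable [HeytingPretopos C]

theorem isEquivalenceRelation_of_holds {Z : C} (R : Subobject (Z ⨯ Z))
    (refl : ∀ ⦃T : C⦄ (a : T ⟶ Z), Holds R (prod.lift a a))
    (symm : ∀ ⦃T : C⦄ (a b : T ⟶ Z), Holds R (prod.lift a b) → Holds R (prod.lift b a))
    (trans : ∀ ⦃T : C⦄ (a b c : T ⟶ Z), Holds R (prod.lift a b) → Holds R (prod.lift b c) →
      Holds R (prod.lift a c)) :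
    IsEquivalenceRelation (R.arrow ≫ prod.fst) (R.arrow ≫ prod.snd) := by
  have key : ∀ {T : C} (a b : T ⟶ Z), Holds R (prod.lift a b) →
      ∃ r : T ⟶ (R : C), r ≫ R.arrow ≫ prod.fst = a ∧ r ≫ R.arrow ≫ prod.snd = b := by
    intro T a b h
    refine ⟨R.factorThru _ h, ?_, ?_⟩
    · rw [← Category.assoc, h.fac, prod.lift_fst]
    · rw [← Category.assoc, h.fac, prod.lift_snd]
  have key' : ∀ {T : C} (r : T ⟶ (R : C)),
      Holds R (prod.lift (r ≫ R.arrow ≫ prod.fst) (r ≫ R.arrow ≫ prod.snd)) := by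
    intro T r
    have : prod.lift (r ≫ R.arrow ≫ prod.fst) (r ≫ R.arrow ≫ prod.snd) = r ≫ R.arrow := by
      apply prod.hom_ext
      · rw [prod.lift_fst, Category.assoc]
      · rw [prod.lift_snd, Category.assoc]
    rw [this]
    exact holds_comp_arrow _
  obtain ⟨r, hr₁, hr₂⟩ := key _ _ (refl (𝟙 Z))
  have hs := key' (𝟙 (R : C))
  rw [Category.id_comp, Category.id_comp] at hs
  obtain ⟨s, hs₁, hs₂⟩ := key _ _ (symm _ _ hs)
  have hp := key' (pullback.fst (R.arrow ≫ prod.snd) (R.arrow ≫ prod.fst))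
  rw [pullback.condition] at hp
  obtain ⟨t, ht₁, ht₂⟩ := key _ _ (trans _ _ _ hp (key' _))
  exact ⟨⟨{
    right_cancellation := fun Y f g h₁ h₂ => by
      rw [← cancel_mono R.arrow]
      apply prod.hom_ext
      · simpa only [Category.assoc] using h₁
      · simpa only [Category.assoc] using h₂
    r := r
    reflexivity₁ := hr₁
    reflexivity₂ := hr₂
    s := s
    symmetry₁ := hs₁
    symmetry₂ := hs₂
    c := pullback.cone _ _
    isLimit := pullback.isLimit _ _
    t := t
    transitivity₁ := ht₁
    transitivity₂ := ht₂ }⟩⟩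

/-- This is how effectiveness is used: the quotient identifies exactly the related generalized
elements. -/
theorem comp_eq_iff_holds {Z Q : C} {R : Subobject (Z ⨯ Z)} {q : Z ⟶ Q}
    (h : IsKernelPair q (R.arrow ≫ prod.fst) (R.arrow ≫ prod.snd)) {T : C} (a b : T ⟶ Z) :
    a ≫ q = b ≫ q ↔ Holds R (prod.lift a b) := by
  constructor
  · intro hab
    have : prod.lift a b = h.lift a b hab ≫ R.arrow := by
      apply prod.hom_ext
      · rw [prod.lift_fst, Category.assoc, h.lift_fst]
      · rw [prod.lift_snd, Category.assoc, h.lift_snd]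
    rw [this]
    exact holds_comp_arrow _
  · intro hab
    calc a ≫ q = R.factorThru _ hab ≫ (R.arrow ≫ prod.fst) ≫ q := by
          rw [← Category.assoc, ← Category.assoc, hab.fac, prod.lift_fst]
      _ = b ≫ q := by rw [h.w, ← Category.assoc, ← Category.assoc, hab.fac, prod.lift_snd]

/-- A monomorphism `m` is the equalizer of its two maps to the quotient of `B ⨿ B` that identifies
the two copies of a point `b` exactly when `b` lies in the image of `m`. -/
theorem isIso_of_mono_epi {A B : C} (m : A ⟶ B) [Mono m] [Epi m] : IsIso m := by
  let π : B ⨿ B ⟶ B := coprod.desc (𝟙 B) (𝟙 B)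
  have hπl : coprod.inl ≫ π = 𝟙 B := coprod.inl_desc _ _
  have hπr : coprod.inr ≫ π = 𝟙 B := coprod.inr_desc _ _
  -- U is everything on the right copy of B, and exactly the image of m on the left copy.
  let U : Subobject (B ⨿ B) :=
    imp (Subobject.mk (coprod.inl : B ⟶ B ⨿ B)) (pb π (Subobject.mk m))
  let R : Subobject ((B ⨿ B) ⨯ (B ⨿ B)) :=
    equalizerSubobject (prod.fst ≫ π) (prod.snd ≫ π) ⊓ biimp (pb prod.fst U) (pb prod.snd U)
  have hR : ∀ ⦃T : C⦄ (a b : T ⟶ B ⨿ B),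
      Holds R (prod.lift a b) ↔ a ≫ π = b ≫ π ∧ pb a U = pb b U := by
    intro T a b
    rw [holds_inf_iff, Holds, equalizerSubobject_factors_iff, holds_biimp_iff,
      prod.lift_fst_assoc, prod.lift_snd_assoc, ← pb_comp, ← pb_comp, prod.lift_fst, prod.lift_snd]
  obtain ⟨⟨E⟩⟩ := HeytingPretopos.effective _ _ (isEquivalenceRelation_of_holds R
    (fun T a => (hR a a).2 ⟨rfl, rfl⟩)
    (fun T a b h => (hR b a).2 ⟨((hR a b).1 h).1.symm, ((hR a b).1 h).2.symm⟩)
    (fun T a b c h h' => (hR a c).2 ⟨((hR a b).1 h).1.trans ((hR b c).1 h').1,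
      ((hR a b).1 h).2.trans ((hR b c).1 h').2⟩))
  have hl : pb coprod.inl U = Subobject.mk m := by
    refine eq_of_forall_holds fun T x => ?_
    rw [holds_pb_iff, holds_imp_iff]
    have hx : ∀ ⦃T' : C⦄ (t : T' ⟶ T), Holds (pb π (Subobject.mk m)) (t ≫ x ≫ coprod.inl) ↔
        Holds (Subobject.mk m) (t ≫ x) := by
      intro T' t
      rw [holds_pb_iff, Category.assoc, Category.assoc, hπl, Category.comp_id]
    constructor
    · intro h
      have := (hx (𝟙 T)).1 (h _ ((holds_mk_iff _ _).2 ⟨x, (Category.id_comp _).symm⟩))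
      rwa [Category.id_comp] at this
    · intro h T' t _
      exact (hx t).2 (h.comp t)
  have hr : pb coprod.inr U = ⊤ := by
    refine top_le_iff.1 (le_of_forall_holds fun T x _ => ?_)
    rw [holds_pb_iff, holds_imp_iff]
    intro T' t ht
    obtain ⟨y, hy⟩ := (holds_mk_iff _ _).1 ht
    -- A point in both copies maps its domain to the initial object, by disjointness; strictness
    -- makes that domain initial, so any membership holds.
    let l : T' ⟶ ⊥_ C := (FinitaryExtensive.isPullback_initial_to_binaryCofan
      (coprodIsCoprod B B)).lift y (t ≫ x) (hy.trans (Category.assoc _ _ _).symm)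
    have : IsIso l := (initialIsInitial (C := C)).isIso_to l
    have hT' : IsInitial T' := initialIsInitial.ofIso (asIso l).symm
    rw [holds_pb_iff, holds_mk_iff]
    exact ⟨hT'.to _, hT'.hom_ext _ _⟩
  have h₁ : m ≫ coprod.inl ≫ E.π = m ≫ coprod.inr ≫ E.π := by
    rw [← Category.assoc, ← Category.assoc, comp_eq_iff_holds E.isKernelPair, hR]
    refine ⟨by rw [Category.assoc, Category.assoc, hπl, hπr], ?_⟩
    rw [pb_comp, pb_comp, hl, hr, pb_top, ← factors_iff_pb_eq_top]
    exact Subobject.mk_factors_self m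
  -- Cancelling the epi m identifies the two copies of every point of B, so U agrees on them.
  rw [cancel_epi, comp_eq_iff_holds E.isKernelPair, hR, hl, hr] at h₁
  exact (Subobject.isIso_iff_mk_eq_top m).2 h₁.2

/-- The mono part of the image factorization of an epi is itself epi, hence invertible. The
epimorphisms of Collection thereby become covers along which maps and memberships descend. -/
instance : IsRegularEpiCategory C where
  regularEpiOfEpi {X Y} f _ := by
    let F := Regular.strongEpiMonoFactorisation f
    have : Epi (F.e ≫ F.m) := by rw [F.fac]; infer_instance
    have : Epi F.m := epi_of_epi F.e F.m
    have : IsIso F.m := isIso_of_mono_epi F.m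
    have : StrongEpi (F.e ≫ F.m) := strongEpi_comp F.e F.m
    rw [F.fac] at this
    infer_instance

theorem isRegularEpi_of_epi {X Y : C} (f : X ⟶ Y) [Epi f] : IsRegularEpi f :=
  IsRegularEpiCategory.regularEpiOfEpi f

end Exactness

variable [HeytingPretopos C]

section SmallSubobjects

/-! ### Small subobjects -/

theorem isPullback_prodMap_fst {A A' : C} (a : A' ⟶ A) (X : C) :
    IsPullback (prod.map a (𝟙 X)) prod.fst prod.fst a := by
  refine ⟨⟨by simp only [prod.map_fst]⟩,
    ⟨PullbackCone.IsLimit.mk _ (fun s => prod.lift s.snd (s.fst ≫ prod.snd)) ?_ ?_ ?_⟩⟩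
  · intro s
    have := s.condition
    apply prod.hom_ext
    · simp only [Category.assoc, prod.map_fst, prod.lift_fst_assoc, this]
    · simp only [Category.assoc, prod.map_snd, Category.comp_id, prod.lift_snd]
  · intro s
    simp only [prod.lift_fst]
  · intro s m h1 h2
    apply prod.hom_ext
    · simp only [prod.lift_fst, h2]
    · simp only [prod.lift_snd, ← h1, Category.assoc, prod.map_snd, Category.comp_id]

theorem IsQuasiPullback.exists_epi {Y X B A P : C} {k : Y ⟶ X} {g : Y ⟶ B} {f : X ⟶ A} {h : B ⟶ A}
    (hq : IsQuasiPullback k g f h) {k' : P ⟶ X} {g' : P ⟶ B} (sq : IsPullback k' g' f h) :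
    ∃ l : Y ⟶ P, IsRegularEpi l ∧ l ≫ k' = k ∧ l ≫ g' = g := by
  obtain ⟨w, hw⟩ := hq
  refine ⟨pullback.lift g k w ≫ sq.flip.isoPullback.inv, ?_, ?_, ?_⟩
  · exact isRegularEpi_of_epi _
  · rw [Category.assoc, sq.flip.isoPullback_inv_snd, pullback.lift_snd]
  · rw [Category.assoc, sq.flip.isoPullback_inv_fst, pullback.lift_fst]

variable (𝒮 : MorphismProperty C) [IsFamilyOfSmallMaps 𝒮]

theorem small_pb {X Y : C} (f : X ⟶ Y) {S : Subobject Y} (h : 𝒮 S.arrow) : 𝒮 (pb f S).arrow :=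
  IsFamilyOfSmallMaps.pullback_stable (Subobject.isPullback f S) h

/-- The image is a quotient of S over A, so the Quotients axiom applies. -/
theorem small_ex {X Y A : C} (f : X ⟶ Y) (g : Y ⟶ A) {S : Subobject X} (h : 𝒮 (S.arrow ≫ f ≫ g)) :
    𝒮 ((ex f S).arrow ≫ g) := by
  obtain ⟨q, hq, hqf⟩ := exists_ex_cover f S
  refine IsFamilyOfSmallMaps.quotient q _ inferInstance ?_
  rwa [← Category.assoc, hqf, Category.assoc]

theorem isIndexedFamily_pb {A A' X : C} (a : A' ⟶ A) {S : Subobject (A ⨯ X)}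
    (h : IsIndexedFamily 𝒮 S) : IsIndexedFamily 𝒮 (pb (prod.map a (𝟙 X)) S) :=
  IsFamilyOfSmallMaps.pullback_stable
    ((Subobject.isPullback (prod.map a (𝟙 X)) S).paste_vert (isPullback_prodMap_fst a X)) h

theorem chi_spec {A X : C} (S : Subobject (A ⨯ X)) (hS : IsIndexedFamily 𝒮 S) :
    pb (prod.map (chi 𝒮 S hS) (𝟙 X)) (mem 𝒮 X) = S :=
  ((powerObject 𝒮 X).classify S hS).choose_spec.1

theorem isIndexedFamily_pb_mem {A X : C} (a : A ⟶ Pow 𝒮 X) :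
    IsIndexedFamily 𝒮 (pb (prod.map a (𝟙 X)) (mem 𝒮 X)) :=
  isIndexedFamily_pb 𝒮 a (powerObject 𝒮 X).mem_small

theorem pow_hom_ext {A X : C} {a b : A ⟶ Pow 𝒮 X}
    (h : pb (prod.map a (𝟙 X)) (mem 𝒮 X) = pb (prod.map b (𝟙 X)) (mem 𝒮 X)) : a = b :=
  ((powerObject 𝒮 X).classify _ (isIndexedFamily_pb_mem 𝒮 b)).unique h rfl

instance isIso_prod_fst_terminal (T : C) : IsIso (prod.fst : T ⨯ ⊤_ C ⟶ T) :=
  (prod.rightUnitor T).isIso_hom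

theorem isIndexedFamily_pb_fst_iff {T : C} (U : Subobject T) :
    IsIndexedFamily 𝒮 (pb (prod.fst : T ⨯ ⊤_ C ⟶ T) U) ↔ 𝒮 U.arrow := by
  have sq := Subobject.isPullback (prod.fst : T ⨯ ⊤_ C ⟶ T) U
  have hi : IsIso (Subobject.pullbackπ (prod.fst : T ⨯ ⊤_ C ⟶ T) U) := sq.isIso_fst_of_isIso
  rw [IsIndexedFamily, ← sq.w]
  refine ⟨fun h => ?_, fun h => IsFamilyOfSmallMaps.comp _ _ (IsFamilyOfSmallMaps.of_isIso _ hi) h⟩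
  have := IsFamilyOfSmallMaps.comp _ _ (IsFamilyOfSmallMaps.of_isIso (𝒮 := 𝒮) (inv
    (Subobject.pullbackπ (prod.fst : T ⨯ ⊤_ C ⟶ T) U)) inferInstance) h
  rwa [IsIso.inv_hom_id_assoc] at this

/-- The membership relation of `P(1)` is the subobject `{p : Ω | p}`. -/
theorem mem_terminal : mem 𝒮 (⊤_ C) = pb prod.fst (Tr 𝒮) := by
  let s : Om 𝒮 ⟶ Om 𝒮 ⨯ ⊤_ C := prod.lift (𝟙 _) (terminal.from _)
  have hs : prod.fst ≫ s = 𝟙 _ := by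
    apply prod.hom_ext
    · rw [Category.assoc, prod.lift_fst, Category.comp_id, Category.id_comp]
    · exact Subsingleton.elim _ _
  -- A family of subobjects of 1 indexed by T is just a subobject of T, since `prod.fst : T ⨯ ⊤_ C ⟶
  -- T` is invertible with inverse of the form of `s`.
  have key : ∀ {T : C} (x : T ⟶ Om 𝒮), pb (prod.map x (𝟙 _)) (mem 𝒮 (⊤_ C)) = ⊤ ↔
      Holds (pb s (mem 𝒮 (⊤_ C))) x := by
    intro T x
    have : prod.map x (𝟙 (⊤_ C)) = (prod.fst : T ⨯ ⊤_ C ⟶ T) ≫ x ≫ s := by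
      rw [← prod.map_fst_assoc x (𝟙 (⊤_ C)), hs, Category.comp_id]
    rw [this, pb_comp, pb_comp, holds_iff_pb_eq_top]
    refine ⟨fun h => ?_, fun h => by rw [h, pb_top]⟩
    have h' := congrArg (pb (inv (prod.fst : T ⨯ ⊤_ C ⟶ T))) h
    rwa [← pb_comp, IsIso.inv_hom_id, pb_id, pb_top] at h'
  have hM : pb s (mem 𝒮 (⊤_ C)) = Tr 𝒮 := by
    refine eq_of_forall_holds fun T x => ?_
    rw [← key, Tr, holds_mk_iff]
    have ht : pb (prod.map (truth 𝒮) (𝟙 _)) (mem 𝒮 (⊤_ C)) = ⊤ := chi_spec 𝒮 _ _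
    constructor
    · intro h
      refine ⟨terminal.from _, pow_hom_ext 𝒮 ?_⟩
      rw [h, ← Category.comp_id (𝟙 (⊤_ C)), ← prod.map_map, pb_comp, ht, pb_top]
    · rintro ⟨y, rfl⟩
      rw [← Category.comp_id (𝟙 (⊤_ C)), ← prod.map_map, pb_comp, ht, pb_top]
  rw [← hM, ← pb_comp, hs, pb_id]

theorem pb_map_mem_terminal {T : C} (p : T ⟶ Om 𝒮) :
    pb (prod.map p (𝟙 _)) (mem 𝒮 (⊤_ C)) = pb prod.fst (pb p (Tr 𝒮)) := by
  rw [mem_terminal, ← pb_comp, prod.map_fst, pb_comp]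

theorem small_truth : 𝒮 (Tr 𝒮).arrow := by
  rw [← isIndexedFamily_pb_fst_iff 𝒮, ← mem_terminal]
  exact (powerObject 𝒮 _).mem_small

/-- Ω classifies small subobjects: transport the classification for P(1) along T ⨯ 1 ≅ T. -/
theorem exists_char {T : C} {U : Subobject T} (h : 𝒮 U.arrow) : ∃ p : T ⟶ Om 𝒮, pb p (Tr 𝒮) = U := by
  refine ⟨chi 𝒮 _ ((isIndexedFamily_pb_fst_iff 𝒮 U).2 h), ?_⟩
  have h' := pb_map_mem_terminal 𝒮 (chi 𝒮 _ ((isIndexedFamily_pb_fst_iff 𝒮 U).2 h))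
  rw [chi_spec] at h'
  have h'' := congrArg (pb (inv prod.fst)) h'
  rwa [← pb_comp, ← pb_comp, IsIso.inv_hom_id, pb_id, pb_id, eq_comm] at h''

theorem om_hom_ext {T : C} {p q : T ⟶ Om 𝒮} (h : pb p (Tr 𝒮) = pb q (Tr 𝒮)) : p = q := by
  apply pow_hom_ext
  rw [pb_map_mem_terminal, pb_map_mem_terminal, h]

end SmallSubobjects

section Covers

/-! ### Covering small subobjects and the closure operator -/

variable {𝒮 : MorphismProperty C} [IsFamilyOfSmallMaps 𝒮] (J : LTCoverage 𝒮)

/-- A small subobject is covering if its classifying map to `Ω` lands in `J`. -/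
def Covers {T : C} (U : Subobject T) : Prop :=
  ∃ p : T ⟶ Om 𝒮, Holds J.J p ∧ pb p (Tr 𝒮) = U

variable {J}

theorem Covers.small {T : C} {U : Subobject T} (h : Covers J U) : 𝒮 U.arrow := by
  obtain ⟨p, -, rfl⟩ := h
  exact small_pb 𝒮 p (small_truth 𝒮)

theorem Covers.pb {T T' : C} {U : Subobject T} (h : Covers J U) (t : T' ⟶ T) :
    Covers J (pb t U) := by
  obtain ⟨p, hp, rfl⟩ := h
  exact ⟨t ≫ p, hp.comp t, pb_comp _ _ _⟩

/-- Uniqueness of classifying maps makes the one upstairs a restriction of the one for U, and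
membership in J descends. -/
theorem Covers.of_epi {T T' : C} {U : Subobject T} (hU : 𝒮 U.arrow) (e : T' ⟶ T) [IsRegularEpi e]
    (h : Covers J (LTSheaves.pb e U)) : Covers J U := by
  obtain ⟨p, hp, hpU⟩ := h
  obtain ⟨q, rfl⟩ := exists_char 𝒮 hU
  obtain rfl : p = e ≫ q := om_hom_ext 𝒮 (by rw [hpU, pb_comp])
  exact ⟨q, hp.of_comp e, rfl⟩

theorem covers_top (T : C) : Covers J (⊤ : Subobject T) := by
  refine ⟨terminal.from T ≫ truth 𝒮, ?_, ?_⟩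
  · rw [← holds_pb_iff, J.top_mem]
    exact holds_top _
  · rw [← holds_iff_pb_eq_top, Tr, holds_mk_iff]
    exact ⟨_, rfl⟩

/-- The second axiom on J, instantiated at the classifying maps of U and V. -/
theorem Covers.trans {T : C} {U V : Subobject T} (hU : Covers J U) (hV : 𝒮 V.arrow)
    (h : Covers J (LTSheaves.pb U.arrow V)) : Covers J V := by
  obtain ⟨p, hp, rfl⟩ := hU
  obtain ⟨q, rfl⟩ := exists_char 𝒮 hV
  obtain ⟨r, hr, hrq⟩ := h
  obtain rfl : r = (LTSheaves.pb p (Tr 𝒮)).arrow ≫ q := om_hom_ext 𝒮 (by rw [hrq, pb_comp])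
  refine ⟨q, ?_, rfl⟩
  have h₁ := holds_top (prod.lift p q)
  rw [← J.trans, holds_imp_iff] at h₁
  -- The premise p ⇒ J(q): where p holds one is inside U, and there V is covering by `h`.
  have h₂ := h₁ (𝟙 T) ((holds_imp_iff _ _ _).2 fun T' t ht => ?_)
  · rw [holds_imp_iff] at h₂
    have h₃ := h₂ (𝟙 T) ?_
    · simpa only [holds_pb_iff, Category.assoc, Category.id_comp, prod.lift_snd] using h₃
    · simpa only [holds_pb_iff, Category.assoc, Category.id_comp, prod.lift_fst] using hp
  · simp only [holds_pb_iff, Category.assoc, Category.id_comp, prod.lift_fst,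
      prod.lift_snd] at ht ⊢
    rw [← holds_pb_iff] at ht
    rw [← ht.fac, Category.assoc]
    exact hr.comp _

theorem Covers.of_le {T : C} {U V : Subobject T} (hU : Covers J U) (hV : 𝒮 V.arrow) (h : U ≤ V) :
    Covers J V := by
  refine hU.trans hV ?_
  rw [(holds_iff_pb_eq_top V U.arrow).1 ((holds_arrow U).of_le h)]
  exact covers_top _

variable (J)

/-- The existential over Ω unwinds to a cover carrying a small covering subobject. -/
theorem holds_closure_iff {X T : C} (S : Subobject X) (x : T ⟶ X) :
    Holds (closure J S) x ↔ ∃ (T' : C) (e : T' ⟶ T) (U : Subobject T'),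
      IsRegularEpi e ∧ Covers J U ∧ U ≤ pb (e ≫ x) S := by
  constructor
  · intro h
    obtain ⟨T', e, y, he, hy, hyx⟩ := Holds.exists_of_ex h
    obtain ⟨h₁, h₂⟩ := (holds_inf_iff _ _ _).1 hy
    refine ⟨T', e, pb (y ≫ prod.fst) (Tr 𝒮), he, ⟨_, (holds_pb_iff _ _ _).1 h₁, rfl⟩, ?_⟩
    refine le_of_forall_holds fun T'' t ht => ?_
    rw [holds_imp_iff] at h₂
    have := h₂ t ?_
    · rwa [holds_pb_iff, Category.assoc, hyx, ← holds_pb_iff] at this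
    · rwa [holds_pb_iff, Category.assoc, ← holds_pb_iff]
  · rintro ⟨T', e, U, he, ⟨p, hp, rfl⟩, hU⟩
    refine Holds.of_comp e ?_
    have : e ≫ x = prod.lift p (e ≫ x) ≫ prod.snd := by rw [prod.lift_snd]
    rw [this]
    refine holds_ex _ ((holds_inf_iff _ _ _).2 ⟨?_, (holds_imp_iff _ _ _).2 fun T'' t ht => ?_⟩)
    · rwa [holds_pb_iff, prod.lift_fst]
    · rw [holds_pb_iff, Category.assoc, prod.lift_fst, ← holds_pb_iff] at ht
      rw [holds_pb_iff, Category.assoc, prod.lift_snd, ← holds_pb_iff]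
      exact ht.of_le hU

theorem closure_mono {X : C} {S S' : Subobject X} (h : S ≤ S') : closure J S ≤ closure J S' := by
  refine le_of_forall_holds fun T x hx => ?_
  rw [holds_closure_iff] at hx ⊢
  obtain ⟨T', e, U, he, hU, hUS⟩ := hx
  exact ⟨T', e, U, he, hU, hUS.trans (pb_mono _ h)⟩

theorem pb_closure {X Y : C} (f : X ⟶ Y) (S : Subobject Y) :
    pb f (closure J S) = closure J (pb f S) := by
  refine eq_of_forall_holds fun T x => ?_
  simp only [holds_pb_iff, holds_closure_iff, ← pb_comp, Category.assoc]

variable {J} in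
theorem Covers.holds_closure {X T : C} {S : Subobject X} {x : T ⟶ X} {U : Subobject T}
    (hU : Covers J U) (h : Holds S (U.arrow ≫ x)) : Holds (closure J S) x := by
  rw [LTSheaves.holds_closure_iff]
  refine ⟨T, 𝟙 T, U, inferInstance, hU, Subobject.le_of_factors ?_⟩
  rwa [Category.id_comp, ← Holds, holds_pb_iff]

/-- By Collection, small covers chosen locally over a small cover can be amalgamated. -/
theorem closure_closure {X : C} (S : Subobject X) : closure J (closure J S) = closure J S := by
  refine le_antisymm (le_of_forall_holds fun T₀ x₀ hx₀ => ?_) (le_closure J _)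
  obtain ⟨T, e, U, he, hU, hUS⟩ := (holds_closure_iff J _ _).1 hx₀
  refine Holds.of_comp e ?_
  generalize e ≫ x₀ = x at hUS ⊢
  have hx := (holds_arrow U).of_le hUS
  rw [holds_pb_iff, holds_closure_iff] at hx
  obtain ⟨P, e₁, V, he₁, hV, hVS⟩ := hx
  obtain ⟨Y, B, q, g, h, hg, hh, hq⟩ :=
    IsFamilyOfSmallMaps.collection U.arrow e₁ hU.small inferInstance
  have := isRegularEpi_of_epi h
  obtain ⟨l, hl, hl₁, hl₂⟩ := hq.exists_epi (Subobject.isPullback h U)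
  have hw : g ≫ h = q ≫ e₁ ≫ U.arrow := by rw [← Category.assoc q]; exact hq.choose
  -- The amalgamated cover is the image in B of the local covers V pulled back to Y; it is small
  -- because V → Y and g are.
  have hWs : 𝒮 (ex g (pb q V)).arrow := by
    have := small_ex 𝒮 g (𝟙 B) (S := pb q V) (by
      rw [Category.comp_id]
      exact IsFamilyOfSmallMaps.comp _ _ (small_pb 𝒮 q hV.small) hg)
    rwa [Category.comp_id] at this
  have hW : Covers J (ex g (pb q V)) := by
    -- By transitivity it suffices to cover the pullback of U to B, and this may be checked on Y,
    -- where the image contains the pullback of V.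
    refine (hU.pb h).trans hWs (Covers.of_epi (small_pb 𝒮 _ hWs) l ?_)
    rw [← pb_comp, hl₂]
    exact (hV.pb q).of_le (small_pb 𝒮 _ hWs) ((ex_le_iff _ _ _).1 le_rfl)
  refine (holds_closure_iff J _ _).2 ⟨B, h, _, inferInstance, hW, ?_⟩
  rw [ex_le_iff, ← pb_comp, ← Category.assoc, hw, Category.assoc, Category.assoc, pb_comp]
  exact pb_mono q hVS

theorem closure_top (X : C) : closure J (⊤ : Subobject X) = ⊤ :=
  top_le_iff.1 (le_closure J _)

end Covers

section SheafCriteria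

/-! ### Sheaves and covers -/

variable {𝒮 : MorphismProperty C} [IsFamilyOfSmallMaps 𝒮] {J : LTCoverage 𝒮}

theorem isRegularEpi_of_isPullback {Y X B A : C} {k : Y ⟶ X} {g : Y ⟶ B} {f : X ⟶ A} {h : B ⟶ A}
    (sq : IsPullback k g f h) [IsRegularEpi h] : IsRegularEpi k :=
  Regular.regularEpiIsStableUnderBaseChange.of_isPullback sq.flip
    ((MorphismProperty.regularEpi_iff h).2 inferInstance)

/-- A dense mono contains, locally on its codomain, a covering subobject. Separatedness makes the
local extensions agree on overlaps, so they descend to an actual extension; thus `ext` need only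
supply extensions after a cover. -/
theorem isSheaf_of_local {Y : C}
    (sep : ∀ ⦃T : C⦄ (U : Subobject T), Covers J U → ∀ g g' : T ⟶ Y,
      U.arrow ≫ g = U.arrow ≫ g' → g = g')
    (ext : ∀ ⦃T : C⦄ (U : Subobject T), Covers J U → ∀ k : (U : C) ⟶ Y,
      ∃ (B : C) (h : B ⟶ T) (w : B ⟶ Y), IsRegularEpi h ∧
        ∀ ⦃Z : C⦄ (b : Z ⟶ B) (u : Z ⟶ (U : C)), b ≫ h = u ≫ U.arrow → b ≫ w = u ≫ k) :
    IsSheaf J Y := by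
  intro D A m _ hm
  have h₁ := holds_top (𝟙 A)
  rw [← show closure J (Subobject.mk m) = ⊤ from hm, holds_closure_iff] at h₁
  obtain ⟨A', e, U, he, hU, hUm⟩ := h₁
  rw [Category.comp_id] at hUm
  obtain ⟨l, hl⟩ := (holds_mk_iff _ _).1 ((holds_pb_iff _ _ _).1 ((holds_arrow U).of_le hUm))
  refine ⟨fun g g' hg => ?_, fun f => ?_⟩
  · rw [← cancel_epi e]
    refine sep U hU _ _ ?_
    dsimp only at hg
    rw [← Category.assoc, ← hl, Category.assoc, hg, ← Category.assoc, hl, Category.assoc]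
  · obtain ⟨B, h, w, hh, hw⟩ := ext U hU (l ≫ f)
    have key : ∀ ⦃Z : C⦄ (b : Z ⟶ B) (z : Z ⟶ D), Holds (pb h U) b → b ≫ h ≫ e = z ≫ m →
        b ≫ w = z ≫ f := by
      intro Z b z hb hz
      rw [holds_pb_iff] at hb
      rw [hw b _ hb.fac.symm, ← Category.assoc]
      congr 1
      rw [← cancel_mono m, Category.assoc, hl, ← Category.assoc, hb.fac, Category.assoc, hz]
    -- The restriction to U is removed by separatedness, since U pulled back to Z is covering.
    have key' : ∀ ⦃Z : C⦄ (b : Z ⟶ B) (z : Z ⟶ D), b ≫ h ≫ e = z ≫ m → b ≫ w = z ≫ f := by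
      intro Z b z hz
      refine sep _ ((hU.pb h).pb b) _ _ ?_
      rw [← Category.assoc, ← Category.assoc]
      refine key _ _ ((holds_pb_iff _ _ _).1 (holds_arrow _)) ?_
      rw [Category.assoc, hz, Category.assoc]
    have := isRegularEpi_of_epi (h ≫ e)
    obtain ⟨d, hd⟩ := exists_desc (h ≫ e) w fun Z a b hab => by
      refine sep _ ((hU.pb h).pb a) _ _ ?_
      have ha := (holds_pb_iff _ _ _).1 (holds_arrow (pb a (pb h U)))
      obtain ⟨u, hu⟩ := ((holds_pb_iff _ _ _).1 ha).exists_lift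
      have hz : ((pb a (pb h U)).arrow ≫ a) ≫ h ≫ e = (u ≫ l) ≫ m := by
        rw [Category.assoc u, hl, ← Category.assoc u, hu, Category.assoc, Category.assoc,
          Category.assoc]
      rw [← Category.assoc, ← Category.assoc, key' _ _ hz]
      refine (key' _ _ ?_).symm
      rw [← hz, Category.assoc, Category.assoc, hab]
    refine ⟨d, ?_⟩
    dsimp only
    rw [← cancel_epi (pullback.fst m (h ≫ e)), ← Category.assoc, pullback.condition,
      Category.assoc, hd]
    exact key' _ _ pullback.condition.symm

theorem IsSheaf.hom_ext {A Y : C} (hY : IsSheaf J Y) {S : Subobject A} (hS : closure J S = ⊤)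
    {g g' : A ⟶ Y} (h : S.arrow ≫ g = S.arrow ≫ g') : g = g' :=
  (hY S.arrow (by rwa [IsDense, Subobject.mk_arrow])).1 h

theorem IsSheaf.exists_ext {A Y : C} (hY : IsSheaf J Y) {S : Subobject A} (hS : closure J S = ⊤)
    (f : (S : C) ⟶ Y) : ∃ g : A ⟶ Y, S.arrow ≫ g = f :=
  (hY S.arrow (by rwa [IsDense, Subobject.mk_arrow])).2 f

/-- The extension into Y stays in S: the inverse image of S is closed and contains a dense
subobject. -/
theorem isSheaf_of_closed {Y : C} (hY : IsSheaf J Y) {S : Subobject Y} (hS : closure J S = S) :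
    IsSheaf J (S : C) := by
  intro B A m _ hm
  refine ⟨fun g g' hg => ?_, fun f => ?_⟩
  · rw [← cancel_mono S.arrow]
    refine (hY m hm).1 ?_
    dsimp only at hg ⊢
    rw [← Category.assoc, hg, Category.assoc]
  · obtain ⟨g, hg⟩ := (hY m hm).2 (f ≫ S.arrow)
    dsimp only at hg
    have hgS : Holds S g := by
      rw [holds_iff_pb_eq_top, ← hS, pb_closure, ← top_le_iff, ← show _ = _ from hm]
      refine closure_mono J (le_of_forall_holds fun T x hx => ?_)
      obtain ⟨y, rfl⟩ := (holds_mk_iff _ _).1 hx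
      rw [holds_pb_iff, Category.assoc, hg, ← Category.assoc]
      exact holds_comp_arrow _
    refine ⟨S.factorThru g hgS, ?_⟩
    dsimp only
    rw [← cancel_mono S.arrow, Category.assoc, hgS.fac, hg]

theorem isSheaf_pullback {X Y Z : C} (f : X ⟶ Z) (g : Y ⟶ Z) (hX : IsSheaf J X) (hY : IsSheaf J Y)
    (hZ : IsSheaf J Z) : IsSheaf J (pullback f g) := by
  intro B A m _ hm
  refine ⟨fun k k' hk => ?_, fun k => ?_⟩
  · dsimp only at hk
    apply pullback.hom_ext
    · refine (hX m hm).1 ?_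
      dsimp only
      rw [← Category.assoc, hk, Category.assoc]
    · refine (hY m hm).1 ?_
      dsimp only
      rw [← Category.assoc, hk, Category.assoc]
  · obtain ⟨a, ha⟩ := (hX m hm).2 (k ≫ pullback.fst f g)
    obtain ⟨b, hb⟩ := (hY m hm).2 (k ≫ pullback.snd f g)
    dsimp only at ha hb
    refine ⟨pullback.lift a b ((hZ m hm).1 ?_), ?_⟩
    · dsimp only
      rw [← Category.assoc, ha, ← Category.assoc, hb, Category.assoc, Category.assoc,
        pullback.condition]
    · apply pullback.hom_ext
      · dsimp only
        rw [Category.assoc, pullback.lift_fst, ha]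
      · dsimp only
        rw [Category.assoc, pullback.lift_snd, hb]

end SheafCriteria

section LocalEquivalences

/-! ### Local equivalences: maps with dense image and dense kernel pair diagonal -/

variable {𝒮 : MorphismProperty C} [IsFamilyOfSmallMaps 𝒮] (J : LTCoverage 𝒮)

theorem holds_equalizerSubobject_iff {X Y T : C} (a b : X ⟶ Y) (x : T ⟶ X) :
    Holds (equalizerSubobject a b) x ↔ x ≫ a = x ≫ b :=
  equalizerSubobject_factors_iff a b x

/-- A map inverted by sheafification: its image is dense, and elements with the same image are
densely equal. -/
structure IsLocalEquiv {X Y : C} (m : X ⟶ Y) : Prop where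
  surj : closure J (imageSubobject m) = ⊤
  inj : ∀ ⦃T : C⦄ (a b : T ⟶ X), a ≫ m = b ≫ m → closure J (equalizerSubobject a b) = ⊤

variable {J}

theorem IsLocalEquiv.bijective {X Y Z : C} {m : X ⟶ Y} (hm : IsLocalEquiv J m)
    (hZ : IsSheaf J Z) : Function.Bijective (fun g : Y ⟶ Z => m ≫ g) := by
  refine ⟨fun g g' hg => ?_, fun f => ?_⟩
  · refine hZ.hom_ext hm.surj ?_
    rw [← cancel_epi (factorThruImageSubobject m), imageSubobject_arrow_comp_assoc,
      imageSubobject_arrow_comp_assoc]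
    exact hg
  · have := isRegularEpi_of_epi (factorThruImageSubobject m)
    obtain ⟨d, hd⟩ := exists_desc (factorThruImageSubobject m) f fun T a b hab => by
      refine hZ.hom_ext (hm.inj a b ?_) ?_
      · rw [← imageSubobject_arrow_comp m, ← Category.assoc, hab, Category.assoc]
      · rw [← Category.assoc, (holds_equalizerSubobject_iff a b _).1 (holds_arrow _),
          Category.assoc]
    obtain ⟨g, hg⟩ := hZ.exists_ext hm.surj d
    refine ⟨g, ?_⟩
    dsimp only
    rw [← hd, ← hg, imageSubobject_arrow_comp_assoc]

theorem IsLocalEquiv.of_isPullback {P X B Y : C} {k : P ⟶ X} {g : P ⟶ B} {m : X ⟶ Y} {h : B ⟶ Y}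
    (sq : IsPullback k g m h) (hm : IsLocalEquiv J m) : IsLocalEquiv J g where
  surj := by
    rw [← top_le_iff, ← pb_top h, ← hm.surj, pb_closure]
    refine closure_mono J (le_of_forall_holds fun T x hx => ?_)
    obtain ⟨T', e, y, he, hy⟩ := ((holds_pb_iff _ _ _).1 hx).exists_of_imageSubobject
    refine Holds.of_comp e ?_
    have := (holds_imageSubobject g).comp (sq.lift y (e ≫ x) (by rw [hy, Category.assoc]))
    rwa [sq.lift_snd] at this
  inj T a b hab := by
    rw [← top_le_iff, ← hm.inj (a ≫ k) (b ≫ k) (by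
      rw [Category.assoc, Category.assoc, sq.w, ← Category.assoc, hab, Category.assoc])]
    refine closure_mono J (le_of_forall_holds fun T x hx => ?_)
    rw [holds_equalizerSubobject_iff] at hx ⊢
    apply sq.hom_ext
    · rw [Category.assoc, Category.assoc, hx]
    · rw [Category.assoc, hab, Category.assoc]

/-- Each half composes two density statements, which idempotence of closure merges into one. -/
theorem IsLocalEquiv.comp {X Y Z : C} {m : X ⟶ Y} {n : Y ⟶ Z} (hm : IsLocalEquiv J m)
    (hn : IsLocalEquiv J n) : IsLocalEquiv J (m ≫ n) where
  surj := by
    rw [← top_le_iff, ← hn.surj, ← closure_closure J (imageSubobject (m ≫ n))]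
    refine closure_mono J (le_of_forall_holds fun T x hx => ?_)
    obtain ⟨T', e, y, he, hy⟩ := hx.exists_of_imageSubobject
    refine Holds.of_comp e ?_
    rw [← hy, ← holds_pb_iff, pb_closure]
    refine Holds.of_le (S := closure J (imageSubobject m)) ?_ (closure_mono J ?_)
    · rw [hm.surj]
      exact holds_top _
    · refine le_of_forall_holds fun T x hx => ?_
      obtain ⟨T', e, y, he, hy⟩ := hx.exists_of_imageSubobject
      refine Holds.of_comp e ?_
      rw [holds_pb_iff, ← hy, Category.assoc]
      exact (holds_imageSubobject (m ≫ n)).comp y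
  inj T a b hab := by
    rw [← Category.assoc, ← Category.assoc] at hab
    rw [← top_le_iff, ← hn.inj _ _ hab, ← closure_closure J (equalizerSubobject a b)]
    refine closure_mono J (le_of_forall_holds fun T x hx => ?_)
    rw [holds_equalizerSubobject_iff, ← Category.assoc, ← Category.assoc] at hx
    rw [holds_iff_pb_eq_top, pb_closure, ← top_le_iff, ← hm.inj _ _ hx]
    refine closure_mono J (le_of_forall_holds fun T' y hy => ?_)
    rw [holds_equalizerSubobject_iff] at hy
    rw [holds_pb_iff, holds_equalizerSubobject_iff, Category.assoc, Category.assoc, hy]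

/-- The inverse is the extension of m along m ≫ n; both composites are identities by uniqueness of
extensions. -/
theorem IsLocalEquiv.isIso {X Y Z : C} {m : X ⟶ Y} {n : Y ⟶ Z} (hm : IsLocalEquiv J m)
    (hmn : IsLocalEquiv J (m ≫ n)) (hY : IsSheaf J Y) (hZ : IsSheaf J Z) : IsIso n := by
  obtain ⟨i, hi⟩ := (hmn.bijective hY).2 m
  dsimp only at hi
  refine ⟨i, (hm.bijective hY).1 ?_, (hmn.bijective hZ).1 ?_⟩
  · dsimp only
    rw [← Category.assoc, hi, Category.comp_id]
  · dsimp only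
    rw [← Category.assoc, hi, Category.comp_id]

end LocalEquivalences

section PowJ

/-! ### The sheaf `P_J(X)` -/

variable {𝒮 : MorphismProperty C} [IsFamilyOfSmallMaps 𝒮] {J : LTCoverage 𝒮}

variable (J) in
/-- The closed family of subobjects of `X` generated by a map to `P(X)`. -/
def closedFamily {X A : C} (a : A ⟶ Pow 𝒮 X) : Subobject (A ⨯ X) :=
  pb (prod.map a (𝟙 X)) (closure J (mem 𝒮 X))

/-- Isolates the index of z, so that an equality of families over that index can be applied to z. -/
theorem holds_iff_holds_lift {X A T : C} (S : Subobject (A ⨯ X)) (z : T ⟶ A ⨯ X) :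
    Holds S z ↔ Holds (pb (prod.map (z ≫ prod.fst) (𝟙 X)) S) (prod.lift (𝟙 T) (z ≫ prod.snd)) := by
  rw [holds_pb_iff, prod.lift_map, Category.id_comp, Category.comp_id, ← prod.comp_lift,
    prod.lift_fst_snd, Category.comp_id]

theorem closedFamily_eq {X A : C} (a : A ⟶ Pow 𝒮 X) :
    closedFamily J a = closure J (pb (prod.map a (𝟙 X)) (mem 𝒮 X)) :=
  pb_closure _ _ _

theorem closedFamily_comp {X A A' : C} (f : A' ⟶ A) (a : A ⟶ Pow 𝒮 X) :
    closedFamily J (f ≫ a) = pb (prod.map f (𝟙 X)) (closedFamily J a) := by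
  rw [closedFamily, closedFamily, ← pb_comp, prod.map_map, Category.comp_id]

instance (X : C) : IsRegularEpi (quot J X) :=
  inferInstanceAs (IsRegularEpi (coequalizer.π (closureRel₁ J X) (closureRel₂ J X)))

theorem closureRel_quot (X : C) : closureRel₁ J X ≫ quot J X = closureRel₂ J X ≫ quot J X :=
  coequalizer.condition (closureRel₁ J X) (closureRel₂ J X)

theorem exists_quot_desc {X Y : C} (f : Pow 𝒮 X ⟶ Y)
    (hf : closureRel₁ J X ≫ f = closureRel₂ J X ≫ f) : ∃ d : PowJ J X ⟶ Y, quot J X ≫ d = f :=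
  ⟨coequalizer.desc f hf, coequalizer.π_desc f hf⟩

theorem comp_quot_eq_iff {X A : C} (a b : A ⟶ Pow 𝒮 X) :
    a ≫ quot J X = b ≫ quot J X ↔ closedFamily J a = closedFamily J b := by
  constructor
  · intro h
    obtain ⟨⟨E⟩⟩ := HeytingPretopos.effective _ _ (closureRel_isEquivalenceRelation J X)
    -- The effective quotient factors through `quot`, so its kernel pair bounds that of `quot`.
    obtain ⟨d, hE⟩ := exists_quot_desc E.π E.isPushout.w
    refine (closureRel_factors_iff J a b).1 ((comp_eq_iff_holds E.isKernelPair a b).1 ?_)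
    rw [← hE, ← Category.assoc, h, Category.assoc]
  · intro h
    obtain ⟨r, rfl, rfl⟩ := closureRel_exists J a b h
    rw [Category.assoc r (closureRel₁ J X), closureRel_quot, ← Category.assoc]

theorem isRegularEpi_prodMap {A A' : C} (e : A' ⟶ A) [IsRegularEpi e] (X : C) :
    IsRegularEpi (prod.map e (𝟙 X)) :=
  isRegularEpi_of_isPullback (isPullback_prodMap_fst e X)

variable (J) in
/-- The closed membership relation on `P_J(X)`. -/
def memJ (X : C) : Subobject (PowJ J X ⨯ X) :=
  ex (prod.map (quot J X) (𝟙 X)) (closure J (mem 𝒮 X))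

/-- Closed membership depends only on the class of the index, so passing to the quotient and back
adds nothing. -/
theorem pb_quot_memJ (X : C) :
    pb (prod.map (quot J X) (𝟙 X)) (memJ J X) = closure J (mem 𝒮 X) := by
  refine le_antisymm (le_of_forall_holds fun T x hx => ?_) ((ex_le_iff _ _ _).1 le_rfl)
  obtain ⟨T', e, y, he, hy, hyx⟩ := ((holds_pb_iff _ _ _).1 hx).exists_of_ex
  refine Holds.of_comp e ?_
  have h₁ : (y ≫ prod.fst) ≫ quot J X = (e ≫ x ≫ prod.fst) ≫ quot J X := by
    have := hyx =≫ prod.fst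
    simpa only [Category.assoc, prod.map_fst] using this
  have h₂ : y ≫ prod.snd = e ≫ x ≫ prod.snd := by
    have := hyx =≫ prod.snd
    simpa only [Category.assoc, prod.map_snd, Category.comp_id] using this
  rw [holds_iff_holds_lift, Category.assoc, Category.assoc, ← h₂]
  rw [holds_iff_holds_lift] at hy
  exact hy.of_le ((comp_quot_eq_iff _ _).1 h₁).le

theorem pb_comp_quot_memJ {X A : C} (a : A ⟶ Pow 𝒮 X) :
    pb (prod.map (a ≫ quot J X) (𝟙 X)) (memJ J X) = closedFamily J a := by
  rw [closedFamily, ← pb_quot_memJ, ← pb_comp, prod.map_map, Category.comp_id]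

theorem eq_of_pb_eq {X Y : C} (e : X ⟶ Y) [IsRegularEpi e] {S S' : Subobject Y}
    (h : pb e S = pb e S') : S = S' := by
  have key : ∀ {S S' : Subobject Y}, pb e S ≤ pb e S' → S ≤ S' := fun {S S'} h => by
    refine le_of_forall_holds fun T x hx => ?_
    refine Holds.of_comp (pullback.fst x e) ?_
    rw [pullback.condition, ← holds_pb_iff]
    refine Holds.of_le ?_ h
    rw [holds_pb_iff, ← pullback.condition]
    exact hx.comp _
  exact le_antisymm (key h.le) (key h.ge)

theorem closure_memJ (X : C) : closure J (memJ J X) = memJ J X := by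
  have := isRegularEpi_prodMap (quot J X) X
  apply eq_of_pb_eq (prod.map (quot J X) (𝟙 X))
  rw [pb_closure, pb_quot_memJ, closure_closure]

/-- Over a common cover both maps lift to P(X), where equality of classes is equality of closed
families. -/
theorem powJ_hom_ext {X A : C} {f g : A ⟶ PowJ J X}
    (h : pb (prod.map f (𝟙 X)) (memJ J X) = pb (prod.map g (𝟙 X)) (memJ J X)) : f = g := by
  have h₁ : (pullback.fst f (quot J X)) ≫ f = _ := pullback.condition
  let e := pullback.fst (pullback.fst f (quot J X) ≫ g) (quot J X)
  have h₂ : e ≫ pullback.fst f (quot J X) ≫ g = _ := pullback.condition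
  rw [← cancel_epi (pullback.fst f (quot J X)), ← cancel_epi e, h₂, h₁, ← Category.assoc,
    comp_quot_eq_iff, ← pb_comp_quot_memJ, ← pb_comp_quot_memJ, ← h₂, Category.assoc, ← h₁,
    ← Category.assoc, ← Category.assoc, ← Category.comp_id (𝟙 X), ← prod.map_map, ← prod.map_map,
    pb_comp, h, ← pb_comp]

/-- The families of g and g' are closed and agree over U; pulling U back along the index of an
element puts it in the closure. -/
theorem powJ_separated {X T : C} {U : Subobject T} (hU : Covers J U) {g g' : T ⟶ PowJ J X}
    (h : U.arrow ≫ g = U.arrow ≫ g') : g = g' := by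
  have key : ∀ {g g' : T ⟶ PowJ J X}, U.arrow ≫ g = U.arrow ≫ g' →
      pb (prod.map g (𝟙 X)) (memJ J X) ≤ pb (prod.map g' (𝟙 X)) (memJ J X) := by
    intro g g' h
    have h₂ : pb (prod.map g' (𝟙 X)) (memJ J X) =
        closure J (pb (prod.map g' (𝟙 X)) (memJ J X)) := by
      rw [← pb_closure, closure_memJ]
    refine le_of_forall_holds fun A x hx => ?_
    rw [h₂]
    refine (hU.pb (x ≫ prod.fst)).holds_closure ?_
    obtain ⟨u, hu⟩ := ((holds_pb_iff _ _ _).1 (holds_arrow (pb (x ≫ prod.fst) U))).exists_lift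
    rw [holds_pb_iff] at hx ⊢
    have : ((pb (x ≫ prod.fst) U).arrow ≫ x) ≫ prod.map g' (𝟙 X) =
        (pb (x ≫ prod.fst) U).arrow ≫ x ≫ prod.map g (𝟙 X) := by
      apply prod.hom_ext
      · have : ((pb (x ≫ prod.fst) U).arrow ≫ x ≫ prod.fst) ≫ g' =
            ((pb (x ≫ prod.fst) U).arrow ≫ x ≫ prod.fst) ≫ g := by
          rw [← hu, Category.assoc, Category.assoc, h]
        simpa only [Category.assoc, prod.map_fst] using this
      · simp only [Category.assoc, prod.map_snd]
    rw [this]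
    exact hx.comp _
  exact powJ_hom_ext (le_antisymm (key h) (key h.symm))

theorem pb_singleton_mem (X : C) :
    pb (prod.map (singleton 𝒮 X) (𝟙 X)) (mem 𝒮 X) = Subobject.mk (prod.lift (𝟙 X) (𝟙 X)) :=
  chi_spec 𝒮 _ _

/-- By Collection, maps to `P_J(X)` extend locally along small covers. -/
theorem isSheaf_powJ (X : C) : IsSheaf J (PowJ J X) := by
  refine isSheaf_of_local (fun T U hU g g' => powJ_separated hU) fun T U hU k => ?_
  obtain ⟨Y, B, q, g, h, hg, hh, hq⟩ := IsFamilyOfSmallMaps.collection U.arrow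
    (pullback.fst k (quot J X)) hU.small inferInstance
  have hw : g ≫ h = (q ≫ pullback.fst k (quot J X)) ≫ U.arrow := hq.choose
  obtain ⟨s, hs⟩ : ∃ s, s ≫ quot J X = (q ≫ pullback.fst k (quot J X)) ≫ k :=
    ⟨q ≫ pullback.snd k (quot J X), by rw [Category.assoc, Category.assoc, pullback.condition]⟩
  let S : Subobject (Y ⨯ X) := pb (prod.map s (𝟙 X)) (mem 𝒮 X)
  -- The union of the locally chosen families along the fibres of g.
  let S' : Subobject (B ⨯ X) := ex (prod.map g (𝟙 X)) S
  have hS' : IsIndexedFamily 𝒮 S' := by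
    refine small_ex 𝒮 _ _ ?_
    rw [prod.map_fst, ← Category.assoc]
    exact IsFamilyOfSmallMaps.comp _ _ (isIndexedFamily_pb_mem 𝒮 s) hg
  -- Two points in one fibre of g lie over the same point of U, since U is a subobject. Their
  -- families thus have the same class under k, and the union adds nothing up to closure.
  have hc : closedFamily J (g ≫ chi 𝒮 S' hS') = closedFamily J s := by
    rw [closedFamily_comp, closedFamily_eq, chi_spec, pb_closure, closedFamily_eq]
    refine le_antisymm ?_ (closure_mono J ((ex_le_iff _ _ _).1 le_rfl))
    rw [← closure_closure J (pb (prod.map s (𝟙 X)) (mem 𝒮 X))]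
    refine closure_mono J (le_of_forall_holds fun A x hx => ?_)
    obtain ⟨A', e, y, he, hy, hyx⟩ := ((holds_pb_iff _ _ _).1 hx).exists_of_ex
    refine Holds.of_comp e ?_
    have h₁ : (y ≫ prod.fst) ≫ g = (e ≫ x ≫ prod.fst) ≫ g := by
      have := hyx =≫ prod.fst
      simpa only [Category.assoc, prod.map_fst] using this
    have h₂ : y ≫ prod.snd = e ≫ x ≫ prod.snd := by
      have := hyx =≫ prod.snd
      simpa only [Category.assoc, prod.map_snd, Category.comp_id] using this
    have h₃ : ((y ≫ prod.fst) ≫ s) ≫ quot J X = ((e ≫ x ≫ prod.fst) ≫ s) ≫ quot J X := by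
      rw [Category.assoc, hs, Category.assoc _ s, hs, ← Category.assoc, ← Category.assoc _ _ k]
      congr 1
      rw [← cancel_mono U.arrow, Category.assoc, ← hw, Category.assoc _ _ U.arrow, ← hw,
        ← Category.assoc, h₁, Category.assoc]
    have hy' := hy.of_le (le_closure J _)
    rw [← closedFamily_eq, holds_iff_holds_lift, ← closedFamily_comp] at hy' ⊢
    rw [Category.assoc e x prod.fst, Category.assoc e x prod.snd, ← h₂]
    exact hy'.of_le ((comp_quot_eq_iff _ _).1 h₃).le
  refine ⟨B, h, chi 𝒮 S' hS' ≫ quot J X, isRegularEpi_of_epi h, fun Z b u hbu => ?_⟩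
  obtain ⟨l, hl, hl₁, hl₂⟩ := hq.exists_epi (IsPullback.of_hasPullback h U.arrow).flip
  let v : Z ⟶ pullback h U.arrow := pullback.lift b u hbu
  -- The pair (b, u) is a point of the pullback of U to B, which Y covers through l; the equation is
  -- checked there.
  rw [← cancel_epi (pullback.fst v l)]
  have hb : pullback.fst v l ≫ b = pullback.snd v l ≫ g := by
    rw [← hl₂, ← pullback.condition_assoc, pullback.lift_fst]
  have hu : pullback.fst v l ≫ u = pullback.snd v l ≫ q ≫ pullback.fst k (quot J X) := by
    rw [← hl₁, ← pullback.condition_assoc, pullback.lift_snd]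
  rw [← Category.assoc, hb, ← Category.assoc _ u, hu, Category.assoc, Category.assoc _ _ k, ← hs,
    ← Category.assoc g, (comp_quot_eq_iff _ _).2 hc]

end PowJ

section AssociatedSheafObject

/-! ### The associated sheaf -/

variable {𝒮 : MorphismProperty C} [IsFamilyOfSmallMaps 𝒮] (J : LTCoverage 𝒮)

theorem isSheaf_assoc (X : C) : IsSheaf J (assoc J X) :=
  isSheaf_of_closed (isSheaf_powJ X) (closure_closure J _)

/-- The inclusion `a(X) ⟶ P_J(X)`. -/
def assocι (X : C) : assoc J X ⟶ PowJ J X := (closure J (imageSigma J X)).arrow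

instance (X : C) : Mono (assocι J X) :=
  inferInstanceAs (Mono (closure J (imageSigma J X)).arrow)

theorem eta_assocι (X : C) : eta J X ≫ assocι J X = sigma J X := by
  have : (factorThruImageSubobject (sigma J X) ≫
      Subobject.ofLE _ _ (le_closure J (imageSigma J X))) ≫
        (closure J (imageSigma J X)).arrow = sigma J X := by
    rw [Category.assoc, Subobject.ofLE_arrow, imageSubobject_arrow_comp]
  exact this

theorem holds_assocι (X : C) : Holds (closure J (imageSigma J X)) (assocι J X) :=
  holds_arrow _

theorem isLocalEquiv_eta (X : C) : IsLocalEquiv J (eta J X) where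
  surj := by
    rw [← top_le_iff, ← (holds_iff_pb_eq_top _ _).1 (holds_assocι J X), pb_closure]
    refine closure_mono J (le_of_forall_holds fun T x hx => ?_)
    obtain ⟨T', e, y, he, hy⟩ := ((holds_pb_iff _ _ _).1 hx).exists_of_imageSubobject
    refine Holds.of_comp e ?_
    have : y ≫ eta J X = e ≫ x := by
      rw [← cancel_mono (assocι J X), Category.assoc, eta_assocι, hy,
        Category.assoc]
    rw [← this]
    exact (holds_imageSubobject _).comp y
  inj T a b hab := by
    have h : (a ≫ singleton 𝒮 X) ≫ quot J X = (b ≫ singleton 𝒮 X) ≫ quot J X := by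
      rw [Category.assoc, Category.assoc, ← sigma, ← eta_assocι, ← Category.assoc, hab,
        Category.assoc]
    rw [comp_quot_eq_iff, closedFamily_comp, closedFamily_comp, closedFamily_eq,
      pb_singleton_mem, pb_closure, pb_closure] at h
    -- Evaluating the closures of {a} and {b} at a: the first is total, the second is the closure of
    -- a = b.
    have h' := congrArg (pb (prod.lift (𝟙 T) a)) h
    rw [pb_closure, pb_closure, ← pb_comp, ← pb_comp, prod.lift_map, prod.lift_map] at h'
    simp only [Category.id_comp, Category.comp_id] at h'
    have ha : pb (prod.lift a a) (Subobject.mk (prod.lift (𝟙 X) (𝟙 X))) = ⊤ := by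
      rw [← holds_iff_pb_eq_top, holds_mk_iff]
      exact ⟨a, by rw [prod.comp_lift, Category.comp_id]⟩
    rw [ha, closure_top] at h'
    rw [← top_le_iff, h']
    refine closure_mono J (le_of_forall_holds fun T' t ht => ?_)
    obtain ⟨y, hy⟩ := (holds_mk_iff _ _).1 ((holds_pb_iff _ _ _).1 ht)
    rw [prod.comp_lift, prod.comp_lift, Category.comp_id] at hy
    have h₁ := hy =≫ prod.fst
    have h₂ := hy =≫ prod.snd
    rw [prod.lift_fst, prod.lift_fst] at h₁
    rw [prod.lift_snd, prod.lift_snd] at h₂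
    rw [holds_equalizerSubobject_iff, ← h₁, ← h₂]

theorem isUniversal (X : C) : IsUniversal J X := fun _ hY f =>
  ((isLocalEquiv_eta J X).bijective hY).existsUnique f

end AssociatedSheafObject

section Sheafification

/-! ### Sheafification: adjunction and left exactness -/

variable {𝒮 : MorphismProperty C} [IsFamilyOfSmallMaps 𝒮] (J : LTCoverage 𝒮)

/-- The sheafification functor. -/
abbrev sheafify : C ⥤ Sh J := assocFunctor J (isSheaf_assoc J) (isUniversal J)

/-- The map `η_X`, as a map to the underlying object of the sheafification of `X`. -/
def toSheafify (X : C) : X ⟶ (sheafify J ⋙ incl J).obj X := eta J X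

theorem isLocalEquiv_toSheafify (X : C) : IsLocalEquiv J (toSheafify J X) :=
  isLocalEquiv_eta J X

theorem isSheaf_sheafify (X : C) : IsSheaf J ((sheafify J ⋙ incl J).obj X) :=
  isSheaf_assoc J X

theorem toSheafify_naturality {X Y : C} (f : X ⟶ Y) :
    toSheafify J X ≫ (sheafify J ⋙ incl J).map f = f ≫ toSheafify J Y :=
  (isUniversal J X _ (isSheaf_assoc J Y) (f ≫ eta J Y)).choose_spec.1

/-- Maps from the sheafification of `X` to a sheaf `Y` correspond to maps from `X` to `Y`. -/
def sheafifyHomEquiv (X : C) (Y : Sh J) : ((sheafify J).obj X ⟶ Y) ≃ (X ⟶ (incl J).obj Y) :=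
  (IsSheaf J).fullyFaithfulι.homEquiv.trans
    (Equiv.ofBijective _ ((isLocalEquiv_toSheafify J X).bijective Y.property))

theorem sheafifyHomEquiv_apply {X : C} {Y : Sh J} (g : (sheafify J).obj X ⟶ Y) :
    sheafifyHomEquiv J X Y g = toSheafify J X ≫ (incl J).map g :=
  rfl

/-- The adjunction between sheafification and inclusion, with unit `eta`. -/
def sheafifyAdjunction : sheafify J ⊣ incl J :=
  Adjunction.mkOfHomEquiv
    { homEquiv := sheafifyHomEquiv J
      homEquiv_naturality_left_symm := fun {X' X Y} f g => by
        rw [Equiv.symm_apply_eq, sheafifyHomEquiv_apply, Functor.map_comp, ← Functor.comp_map,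
          ← Category.assoc, toSheafify_naturality, Category.assoc, ← sheafifyHomEquiv_apply,
          Equiv.apply_symm_apply]
      homEquiv_naturality_right := fun {X Y Y'} f g => by
        rw [sheafifyHomEquiv_apply, sheafifyHomEquiv_apply, Functor.map_comp, Category.assoc] }

theorem sheafifyAdjunction_unit_app (X : C) : (sheafifyAdjunction J).unit.app X = eta J X := by
  rw [sheafifyAdjunction, Adjunction.mkOfHomEquiv_unit_app, sheafifyHomEquiv_apply,
    CategoryTheory.Functor.map_id]
  exact Category.comp_id _

variable {J} in
-- This map is a base change of m, by pasting pullback squares.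
theorem IsLocalEquiv.pullback_lift {X X' Y Z : C} {m : X ⟶ X'} (hm : IsLocalEquiv J m)
    {f' : X ⟶ Z} {f : X' ⟶ Z} (w : m ≫ f = f') (g : Y ⟶ Z) :
    IsLocalEquiv J (pullback.lift (pullback.fst f' g ≫ m) (pullback.snd f' g)
      (by rw [Category.assoc, w, pullback.condition]) : pullback f' g ⟶ pullback f g) := by
  subst w
  refine hm.of_isPullback (k := pullback.fst (m ≫ f) g) (h := pullback.fst f g) ?_
  refine IsPullback.of_bot ?_ ?_ (IsPullback.of_hasPullback f g)
  · rw [pullback.lift_snd]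
    exact IsPullback.of_hasPullback (m ≫ f) g
  · rw [pullback.lift_fst]

variable {J} in
theorem IsLocalEquiv.pullback_lift_right {X Y Y' Z : C} {m : Y ⟶ Y'} (hm : IsLocalEquiv J m)
    (f : X ⟶ Z) {g' : Y ⟶ Z} {g : Y' ⟶ Z} (w : m ≫ g = g') :
    IsLocalEquiv J (pullback.lift (pullback.fst f g') (pullback.snd f g' ≫ m)
      (by rw [Category.assoc, w, pullback.condition]) : pullback f g' ⟶ pullback f g) := by
  subst w
  refine hm.of_isPullback (k := pullback.snd f (m ≫ g)) (h := pullback.snd f g) ?_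
  refine IsPullback.of_bot ?_ ?_ (IsPullback.of_hasPullback f g).flip
  · rw [pullback.lift_fst]
    exact (IsPullback.of_hasPullback f (m ≫ g)).flip
  · rw [pullback.lift_snd]

variable {J} in
-- The map is monic, and dense because elements of Z identified by m are densely equal.
theorem IsLocalEquiv.pullback_diag {X Y Z Z' : C} {m : Z ⟶ Z'} (hm : IsLocalEquiv J m)
    (f : X ⟶ Z) (g : Y ⟶ Z) {f' : X ⟶ Z'} {g' : Y ⟶ Z'} (hf : f ≫ m = f') (hg : g ≫ m = g') :
    IsLocalEquiv J (pullback.lift (pullback.fst f g) (pullback.snd f g)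
      (by rw [← hf, ← hg, pullback.condition_assoc]) : pullback f g ⟶ pullback f' g') where
  surj := by
    rw [← top_le_iff, ← hm.inj (pullback.fst f' g' ≫ f) (pullback.snd f' g' ≫ g) (by
      rw [Category.assoc, hf, Category.assoc, hg, pullback.condition])]
    refine closure_mono J (le_of_forall_holds fun T x hx => ?_)
    rw [holds_equalizerSubobject_iff, ← Category.assoc, ← Category.assoc] at hx
    convert (holds_imageSubobject _).comp (pullback.lift _ _ hx) using 1
    apply pullback.hom_ext
    · rw [Category.assoc, pullback.lift_fst, pullback.lift_fst]
    · rw [Category.assoc, pullback.lift_snd, pullback.lift_snd]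
  inj T a b hab := by
    have : a = b := by
      apply pullback.hom_ext
      · simpa only [Category.assoc, pullback.lift_fst] using hab =≫ pullback.fst f' g'
      · simpa only [Category.assoc, pullback.lift_snd] using hab =≫ pullback.snd f' g'
    rw [this, ← top_le_iff]
    refine le_trans (le_of_forall_holds fun T x _ => ?_) (le_closure J _)
    rw [holds_equalizerSubobject_iff]

theorem isIso_pullbackComparison {X Y Z : C} (f : X ⟶ Z) (g : Y ⟶ Z) :
    IsIso (pullbackComparison (sheafify J ⋙ incl J) f g) := by
  refine (isLocalEquiv_toSheafify J (pullback f g)).isIso ?_ (isSheaf_sheafify J _)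
    (isSheaf_pullback _ _ (isSheaf_sheafify J _) (isSheaf_sheafify J _) (isSheaf_sheafify J _))
  -- Replace Z, then X, then Y by its sheafification. The composite is η followed by the comparison
  -- map, as the two projections show.
  have h := ((isLocalEquiv_toSheafify J Z).pullback_diag f g rfl rfl).comp
    (((isLocalEquiv_toSheafify J X).pullback_lift (toSheafify_naturality J f)
      (g ≫ toSheafify J Z)).comp
        ((isLocalEquiv_toSheafify J Y).pullback_lift_right _ (toSheafify_naturality J g)))
  refine cast (congrArg (IsLocalEquiv J) ?_) h
  apply pullback.hom_ext
  · simp only [Category.assoc, pullbackComparison_comp_fst, toSheafify_naturality,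
      pullback.lift_fst, pullback.lift_fst_assoc]
  · simp only [Category.assoc, pullbackComparison_comp_snd, toSheafify_naturality,
      pullback.lift_snd, pullback.lift_snd_assoc]

theorem isIso_sheafify_terminal :
    IsIso (terminal.from ((sheafify J ⋙ incl J).obj (⊤_ C))) := by
  refine ⟨toSheafify J (⊤_ C), ?_, Subsingleton.elim _ _⟩
  refine ((isLocalEquiv_toSheafify J (⊤_ C)).bijective (isSheaf_sheafify J _)).1 ?_
  dsimp only
  rw [← Category.assoc, Subsingleton.elim (toSheafify J (⊤_ C) ≫ _) (𝟙 (⊤_ C)), Category.id_comp,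
    Category.comp_id]

/-- Terminal object and pullbacks suffice, and both are checked after the inclusion, which reflects
limits because it is fully faithful. -/
theorem preservesFiniteLimits_sheafify : PreservesFiniteLimits (sheafify J) := by
  have : PreservesLimitsOfShape (Discrete PEmpty) (sheafify J ⋙ incl J) := by
    have := isIso_sheafify_terminal J
    have := preservesTerminal_of_isIso (sheafify J ⋙ incl J) (terminal.from _)
    exact preservesLimitsOfShape_pempty_of_preservesTerminal _
  have : PreservesLimitsOfShape WalkingCospan (sheafify J ⋙ incl J) := by
    refine ⟨fun {K} => ?_⟩
    have := isIso_pullbackComparison J (K.map WalkingCospan.Hom.inl) (K.map WalkingCospan.Hom.inr)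
    have : PreservesLimit (cospan (K.map WalkingCospan.Hom.inl) (K.map WalkingCospan.Hom.inr))
        (sheafify J ⋙ incl J) := PreservesPullback.of_iso_comparison _
    exact preservesLimit_of_iso_diagram _ (diagramIsoCospan K).symm
  have : PreservesLimitsOfShape (Discrete PEmpty) (sheafify J) :=
    preservesLimitsOfShape_of_reflects_of_preserves _ (incl J)
  have : PreservesLimitsOfShape WalkingCospan (sheafify J) :=
    preservesLimitsOfShape_of_reflects_of_preserves _ (incl J)
  exact preservesFiniteLimits_of_preservesTerminal_and_pullbacks (sheafify J)

end Sheafification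

end LTSheaves

end

theorem mainTheorem3 {C : Type u} [Category.{v} C] [LTSheaves.HeytingPretopos C]
    (𝒮 : MorphismProperty C) [LTSheaves.IsFamilyOfSmallMaps 𝒮] (J : LTSheaves.LTCoverage 𝒮) :
    ∃ (hs : ∀ X : C, LTSheaves.IsSheaf J (LTSheaves.assoc J X))
      (hu : ∀ X : C, LTSheaves.IsUniversal J X),
      (∃ adj : LTSheaves.assocFunctor J hs hu ⊣ LTSheaves.incl J,
        ∀ X : C, adj.unit.app X = LTSheaves.eta J X) ∧
      PreservesFiniteLimits (LTSheaves.assocFunctor J hs hu) :=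
  ⟨LTSheaves.isSheaf_assoc J, LTSheaves.isUniversal J,
    ⟨LTSheaves.sheafifyAdjunction J, LTSheaves.sheafifyAdjunction_unit_app J⟩,
    LTSheaves.preservesFiniteLimits_sheafify J⟩
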